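/- Let $G$ be a finite group and let $\mathcal O$ be a $G$-transfer system, i.e. a partial order $K\to H$ on the subgroups of $G$ that refines inclusion and is closed under conjugation and under restriction (if $K\to H$ and $L\subseteq H$, then $K\cap L\to L$). Let $\mathcal A^{\mathcal O}$ be the Lindner category: its objects are the finite $G$-sets, and its morphisms $S\to T$ are the isomorphism classes of spans $S\leftarrow U\xrightarrow{h} T$ with $\mathrm{Stab}(u)\to \mathrm{Stab}(h(u))$ in $\mathcal O$ for all $u\in U$. A rational $\mathcal O$-Mackey functor is a product preserving functor from $\mathcal A^{\mathcal O}$ to rational vector spaces. For $J\le G$ let $H_{\mathcal O}(J)$ be the smallest subgroup containing $J$ that transfers to $G$. Subgroups $J,K$ are inseparable if $H_{\mathcal O}(J)$ and $H_{\mathcal O}(K)$ are conjugate in $G$, and $[H]^{\mathcal O}$ denotes the inseparability class of $H$. Fix $H\le G$ with $H\to G$ in $\mathcal O$. A Mackey functor $M$ is concentrated above $[H]^{\mathcal O}$ if $M(G/K)=0$ for every $K$ that contains no member of $[H]^{\mathcal O}$. Let $\mathcal A^{\mathcal O}_{(H)}\subseteq\mathcal A^{\mathcal O}$ be the full subcategory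 on the finite $G$-sets all of whose stabilizers are subconjugate to $H$. A rational $[H]^{\mathcal O}$-Mackey functor is a product preserving functor from $\mathcal A^{\mathcal O}_{(H)}$ to rational vector spaces that vanishes on $G/K$ for every $K\notin[H]^{\mathcal O}$ subconjugate to $H$. Precomposition with $\mathcal A^{\mathcal O}_{(H)}\hookrightarrow\mathcal A^{\mathcal O}$ gives a functor $\mathrm{Res}$ from rational Mackey functors concentrated above $[H]^{\mathcal O}$ to rational $[H]^{\mathcal O}$-Mackey functors, which has a left adjoint $\mathrm{Ind}$ and a right adjoint $\mathrm{CoInd}$ (the left and right Kan extensions). **Theorem.** For every rational $\mathcal O$-Mackey functor $M$ concentrated above $[H]^{\mathcal O}$, the composite of the counit and the unit $$\kappa\colon \mathrm{Ind}\,\mathrm{Res}\,M\longrightarrow M\longrightarrow \mathrm{CoInd}\,\mathrm{Res}\,M$$ is an isomorphism. Moreover, let $L\le G$, let $T_L$ be the set of the subgroups $L\cap gHg^{-1}$ ($g\in G$) that lie in $[H]^{\mathcal O}$, and let $R$ be a set of representatives for the $L$-conjugacy classes in $T_L$. For $J\in R$ the Weyl group $W_L(J)=N_L(J)/J$ acts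 on $M(G/J)$. The transfers from $G/J$ to $G/L$ (applied to the unit $\mathrm{Res}\,M\to\mathrm{Res}\,\mathrm{Ind}\,\mathrm{Res}\,M$ at $G/J$) and the restrictions from $G/L$ to $G/J$ (followed by the counit $\mathrm{Res}\,\mathrm{CoInd}\,\mathrm{Res}\,M\to\mathrm{Res}\,M$ at $G/J$) induce isomorphisms $$\bigoplus_{J\in R}M(G/J)_{W_L(J)}\cong(\mathrm{Ind}\,\mathrm{Res}\,M)(G/L),\qquad (\mathrm{CoInd}\,\mathrm{Res}\,M)(G/L)\cong\prod_{J\in R}M(G/J)^{W_L(J)}.$$ Under these, $\kappa$ at $G/L$ is diagonal, and its component at $J$ is the trace map $M(G/J)_{W_L(J)}\to M(G/J)^{W_L(J)}$, $[m]\mapsto\sum_{w\in W_L(J)}w\,m$, which is bijective. -/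

import Mathlib

open CategoryTheory CategoryTheory.Limits MulAction
open scoped Pointwise

universe u v

namespace IncompleteMackey

/-! ### Transfer systems and inseparability -/

section TransferSystems

variable {G : Type u} [Group G]

/-- The conjugate subgroup `g H g⁻¹`. -/
def conj (g : G) (H : Subgroup G) : Subgroup G := MulAut.conj g • H

/-- A `G`-transfer system: a partial order on `Sub(G)`, written `K → H`, that refines inclusion and
is closed under conjugation and restriction.  (Antisymmetry follows from refining inclusion.) -/
structure TransferSystem (G : Type u) [Group G] where
  rel : Subgroup G → Subgroup G → Prop
  refl : ∀ H, rel H H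
  trans : ∀ {J K H}, rel J K → rel K H → rel J H
  le_of_rel : ∀ {K H}, rel K H → K ≤ H
  conj : ∀ {K H} (g : G), rel K H → rel (IncompleteMackey.conj g K) (IncompleteMackey.conj g H)
  restrict : ∀ {K H L}, rel K H → L ≤ H → rel (K ⊓ L) L

theorem mem_conj {g x : G} {H : Subgroup G} : x ∈ conj g H ↔ g⁻¹ * x * g ∈ H := by
  simp [conj, Subgroup.mem_pointwise_smul_iff_inv_smul_mem, MulAut.smul_def, ← map_inv]

theorem conj_mul (g h : G) (H : Subgroup G) : conj (g * h) H = conj g (conj h H) := by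
  simp [conj, map_mul, mul_smul]

theorem conj_one (H : Subgroup G) : conj 1 H = H := by simp [conj]

theorem conj_mono {g : G} {H K : Subgroup G} (h : H ≤ K) : conj g H ≤ conj g K :=
  fun _ hx => mem_conj.2 (h (mem_conj.1 hx))

theorem conj_top (g : G) : conj g (⊤ : Subgroup G) = ⊤ := by
  ext x; simp [mem_conj]

theorem conj_le_iff {g : G} {H K : Subgroup G} : conj g H ≤ K ↔ H ≤ conj g⁻¹ K := by
  constructor
  · intro h
    have := conj_mono (g := g⁻¹) h
    rwa [← conj_mul, inv_mul_cancel, conj_one] at this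
  · intro h
    have := conj_mono (g := g) h
    rwa [← conj_mul, mul_inv_cancel, conj_one] at this

theorem stabilizer_smul {X : Type*} [MulAction G X] (g : G) (x : X) :
    stabilizer G (g • x) = conj g (stabilizer G x) := by
  ext y
  simp only [mem_conj, mem_stabilizer_iff, mul_smul]
  rw [inv_smul_eq_iff]

variable (O : TransferSystem G)

/-- `H_O(J)`, the smallest subgroup of `G` containing `J` that transfers to `G`. -/
def hull (J : Subgroup G) : Subgroup G := sInf {H | J ≤ H ∧ O.rel H ⊤}

/-- `J` and `K` are inseparable: `H_O(J)` and `H_O(K)` are conjugate in `G`.  Thus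
`Inseparable O H K` says that `K` lies in the inseparability class `[H]^O`. -/
def Inseparable (J K : Subgroup G) : Prop := ∃ g : G, conj g (hull O J) = hull O K

/-- `L ≥ [H]^O`: the subgroup `L` contains a member of the inseparability class of `H`. -/
def IsAbove (H L : Subgroup G) : Prop := ∃ K, Inseparable O H K ∧ K ≤ L

/-- `K` is subconjugate to `H`. -/
def IsSubconj (K H : Subgroup G) : Prop := ∃ g : G, K ≤ conj g H

variable {O}

theorem le_hull (J : Subgroup G) : J ≤ hull O J := le_sInf fun _ h => h.1

theorem hull_le {J H : Subgroup G} (h : J ≤ H) (h' : O.rel H ⊤) : hull O J ≤ H :=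
  sInf_le ⟨h, h'⟩

theorem hull_mono {J K : Subgroup G} (h : J ≤ K) : hull O J ≤ hull O K :=
  sInf_le_sInf fun _ hK => ⟨h.trans hK.1, hK.2⟩

theorem hull_eq {H : Subgroup G} (hH : O.rel H ⊤) : hull O H = H :=
  le_antisymm (hull_le le_rfl hH) (le_hull H)

theorem rel_conj_top {H : Subgroup G} (hH : O.rel H ⊤) (g : G) : O.rel (conj g H) ⊤ := by
  simpa [conj_top] using O.conj g hH

theorem inseparable_of_isAbove [Finite G] {H K : Subgroup G} (hH : O.rel H ⊤)
    (hK : IsSubconj K H) (h : IsAbove O H K) : Inseparable O H K := by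
  obtain ⟨J, ⟨a, ha⟩, hJ⟩ := h
  obtain ⟨g, hg⟩ := hK
  have h1 : hull O J ≤ hull O K := hull_mono hJ
  have h2 : hull O K ≤ conj g H := hull_le hg (rel_conj_top hH g)
  rw [← ha, hull_eq hH] at h1
  have hc : ∀ x : G, Nat.card (conj x H) = Nat.card H := fun x =>
    Nat.card_congr (Subgroup.equivSMul (MulAut.conj x) H).symm.toEquiv
  refine ⟨a, ?_⟩
  rw [hull_eq hH]
  apply le_antisymm h1
  have : conj a H = conj g H := Subgroup.eq_of_le_of_card_ge (h1.trans h2) (by rw [hc, hc])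
  rw [this]; exact h2

theorem IsAbove.mono {H K L : Subgroup G} (h : IsAbove O H K) (hKL : K ≤ L) : IsAbove O H L := by
  obtain ⟨J, hJ, hJK⟩ := h
  exact ⟨J, hJ, hJK.trans hKL⟩

theorem hull_conj (g : G) (J : Subgroup G) : hull O (conj g J) = conj g (hull O J) := by
  have key : ∀ (g : G) (J : Subgroup G), hull O (conj g J) ≤ conj g (hull O J) := by
    intro g J
    have : conj g⁻¹ (hull O (conj g J)) ≤ hull O J := by
      refine le_sInf fun K hK => ?_
      rw [conj_le_iff, inv_inv]
      exact hull_le (conj_mono hK.1) (rel_conj_top hK.2 g)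
    rwa [conj_le_iff, inv_inv] at this
  refine le_antisymm (key g J) ?_
  have := key g⁻¹ (conj g J)
  rw [← conj_mul, inv_mul_cancel, conj_one] at this
  rw [conj_le_iff]; exact this

theorem IsAbove.conj {H K : Subgroup G} (h : IsAbove O H K) (g : G) :
    IsAbove O H (conj g K) := by
  obtain ⟨J, ⟨a, ha⟩, hJK⟩ := h
  exact ⟨IncompleteMackey.conj g J, ⟨g * a, by rw [conj_mul, ha, hull_conj]⟩, conj_mono hJK⟩

end TransferSystems

/-! ### Finite `G`-sets and the Lindner category -/

section Lindner

/-- A finite `G`-set. -/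
structure FinGSet (G : Type u) [Group G] where
  carrier : Type u
  [action : MulAction G carrier]
  [finite : Finite carrier]

variable {G : Type u} [Group G]

instance : CoeSort (FinGSet G) (Type u) := ⟨FinGSet.carrier⟩

attribute [instance] FinGSet.action FinGSet.finite

/-- The orbit `G/K`. -/
def orbitSet [Finite G] (K : Subgroup G) : FinGSet G := ⟨G ⧸ K⟩

/-- The disjoint union of finite `G`-sets. -/
def FinGSet.sum (S T : FinGSet G) : FinGSet G := ⟨S ⊕ T⟩

/-- The empty `G`-set. -/
def FinGSet.empty (G : Type u) [Group G] : FinGSet G where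
  carrier := PEmpty
  action := { smul := fun _ x => x, one_smul := fun x => x.elim, mul_smul := fun _ _ x => x.elim }

variable (O : TransferSystem G)

/-- A `G`-map `f` lies in `Fin^G_O` if `Stab(s) → Stab(f(s))` is in `O` for all `s`. -/
def IsAdmissible {S T : FinGSet G} (f : S →[G] T) : Prop :=
  ∀ s : S, O.rel (stabilizer G s) (stabilizer G (f s))

/-- A span `S ← U → T` of finite `G`-sets whose right leg is in `Fin^G_O`. -/
structure Span (S T : FinGSet G) where
  apex : FinGSet G
  left : apex →[G] S
  right : apex →[G] T
  admissible : IsAdmissible O right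

variable {O}

/-- Isomorphism of spans. -/
def Span.Iso {S T : FinGSet G} (P Q : Span O S T) : Prop :=
  ∃ e : P.apex →[G] Q.apex, Function.Bijective e ∧
    (∀ x, Q.left (e x) = P.left x) ∧ ∀ x, Q.right (e x) = P.right x

variable (O) in
/-- The setoid of isomorphism of spans. -/
def spanSetoid (S T : FinGSet G) : Setoid (Span O S T) where
  r := Span.Iso
  iseqv :=
    { refl := fun P => ⟨MulActionHom.id G, Function.bijective_id, fun _ => rfl, fun _ => rfl⟩
      symm := by
        rintro P Q ⟨e, he, hl, hr⟩
        let e' := Equiv.ofBijective e he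
        refine ⟨e.inverse e'.symm e'.left_inv e'.right_inv, e'.symm.bijective, fun x => ?_,
          fun x => ?_⟩
        · rw [← hl]; exact congrArg _ (e'.apply_symm_apply x)
        · rw [← hr]; exact congrArg _ (e'.apply_symm_apply x)
      trans := by
        rintro P Q R ⟨e, he, hl, hr⟩ ⟨f, hf, hl', hr'⟩
        exact ⟨f.comp e, hf.comp he, fun x => (hl' _).trans (hl x), fun x => (hr' _).trans (hr x)⟩ }

/-- The identity span. -/
def Span.id (S : FinGSet G) : Span O S S :=
  ⟨S, MulActionHom.id G, MulActionHom.id G, fun _ => O.refl _⟩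

/-- The fibre product of two maps of `G`-sets. -/
instance pullbackAction {A B C : Type*} [MulAction G A] [MulAction G B] [MulAction G C]
    (f : A →[G] C) (h : B →[G] C) : MulAction G {p : A × B // f p.1 = h p.2} where
  smul g p := ⟨(g • p.1.1, g • p.1.2), by simp [p.2]⟩
  one_smul p := by ext <;> exact one_smul _ _
  mul_smul g k p := by ext <;> exact mul_smul _ _ _

/-- The composite of spans, through the fibre product. -/
def Span.comp {S T R : FinGSet G} (P : Span O S T) (Q : Span O T R) : Span O S R where
  apex := ⟨{p : P.apex × Q.apex // P.right p.1 = Q.left p.2}⟩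
  left := ⟨fun p => P.left p.1.1, fun g p => map_smul P.left g p.1.1⟩
  right := ⟨fun p => Q.right p.1.2, fun g p => map_smul Q.right g p.1.2⟩
  admissible := by
    rintro ⟨⟨a, b⟩, h⟩
    have h : P.right a = Q.left b := h
    refine O.trans (K := stabilizer G b) ?_ (Q.admissible b)
    have hle : stabilizer G b ≤ stabilizer G (P.right a) := fun g hg => by
      rw [mem_stabilizer_iff] at *
      rw [h, ← map_smul, hg]
    have := O.restrict (P.admissible a) hle
    convert this using 1
    ext g
    rw [Subgroup.mem_inf, mem_stabilizer_iff, mem_stabilizer_iff, mem_stabilizer_iff]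
    constructor
    · intro hg
      exact ⟨congrArg (fun p => p.1.1) hg, congrArg (fun p => p.1.2) hg⟩
    · rintro ⟨h1, h2⟩
      exact Subtype.ext (Prod.ext h1 h2)

/-- The Lindner category `A^O`: objects are finite `G`-sets, morphisms are isomorphism classes of
spans with right leg in `Fin^G_O`. -/
structure Lindner {G : Type u} [Group G] (O : TransferSystem G) where
  set : FinGSet G

theorem Span.comp_congr {S T R : FinGSet G} {P P' : Span O S T} {Q Q' : Span O T R}
    (h : P.Iso P') (k : Q.Iso Q') : (P.comp Q).Iso (P'.comp Q') := by
  obtain ⟨e, he, hl, hr⟩ := h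
  obtain ⟨f, hf, hl', hr'⟩ := k
  refine ⟨⟨fun p => ⟨(e p.1.1, f p.1.2), by rw [hr, hl']; exact p.2⟩, fun g p => ?_⟩,
    ⟨?_, ?_⟩, fun p => hl _, fun p => hr' _⟩
  · exact Subtype.ext (Prod.ext (map_smul e g p.1.1) (map_smul f g p.1.2))
  · intro p q h
    have h := congrArg Subtype.val h
    exact Subtype.ext (Prod.ext (he.1 (congrArg Prod.fst h)) (hf.1 (congrArg Prod.snd h)))
  · rintro ⟨⟨a, b⟩, h⟩
    obtain ⟨a, rfl⟩ := he.2 a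
    obtain ⟨b, rfl⟩ := hf.2 b
    exact ⟨⟨(a, b), by rw [← hr, ← hl']; exact h⟩, rfl⟩

theorem Span.id_comp_iso {S T : FinGSet G} (P : Span O S T) : ((Span.id S).comp P).Iso P := by
  refine ⟨⟨fun p => p.1.2, fun _ _ => rfl⟩, ⟨?_, fun x => ⟨⟨(P.left x, x), rfl⟩, rfl⟩⟩,
    fun p => p.2.symm, fun _ => rfl⟩
  rintro ⟨⟨a, b⟩, h⟩ ⟨⟨a', b'⟩, h'⟩ (hb : b = b')
  subst hb
  have h : a = P.left b := h
  have h' : a' = P.left b := h'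
  exact Subtype.ext (Prod.ext (h.trans h'.symm) rfl)

theorem Span.comp_id_iso {S T : FinGSet G} (P : Span O S T) : (P.comp (Span.id T)).Iso P := by
  refine ⟨⟨fun p => p.1.1, fun _ _ => rfl⟩, ⟨?_, fun x => ⟨⟨(x, P.right x), rfl⟩, rfl⟩⟩,
    fun _ => rfl, fun p => p.2⟩
  rintro ⟨⟨a, b⟩, h⟩ ⟨⟨a', b'⟩, h'⟩ (ha : a = a')
  subst ha
  have h : P.right a = b := h
  have h' : P.right a = b' := h'
  exact Subtype.ext (Prod.ext rfl (h.symm.trans h'))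

theorem Span.assoc_iso {S T R Z : FinGSet G} (P : Span O S T) (Q : Span O T R) (W : Span O R Z) :
    ((P.comp Q).comp W).Iso (P.comp (Q.comp W)) := by
  refine ⟨⟨fun p => ⟨(p.1.1.1.1, ⟨(p.1.1.1.2, p.1.2), p.2⟩), p.1.1.2⟩, fun _ _ => rfl⟩,
    ⟨?_, ?_⟩, fun _ => rfl, fun _ => rfl⟩
  · rintro ⟨⟨⟨⟨a, b⟩, h⟩, c⟩, k⟩ ⟨⟨⟨⟨a', b'⟩, h'⟩, c'⟩, k'⟩ e
    have e1 : a = a' := congrArg (fun p => p.1.1) e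
    have e2 : b = b' := congrArg (fun p => p.1.2.1.1) e
    have e3 : c = c' := congrArg (fun p => p.1.2.1.2) e
    subst e1 e2 e3
    rfl
  · rintro ⟨⟨a, ⟨⟨b, c⟩, k⟩⟩, h⟩
    exact ⟨⟨(⟨(a, b), h⟩, c), k⟩, rfl⟩

instance : Category.{u + 1} (Lindner O) where
  Hom S T := Quotient (spanSetoid O S.set T.set)
  id S := Quotient.mk _ (Span.id S.set)
  comp f g := Quotient.map₂ Span.comp (fun _ _ h _ _ k => Span.comp_congr h k) f g
  id_comp f := by
    induction f using Quotient.ind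
    exact Quotient.sound (Span.id_comp_iso _)
  comp_id f := by
    induction f using Quotient.ind
    exact Quotient.sound (Span.comp_id_iso _)
  assoc f g h := by
    induction f using Quotient.ind
    induction g using Quotient.ind
    induction h using Quotient.ind
    exact Quotient.sound (Span.assoc_iso _ _ _)

/-- The morphism of the Lindner category represented by a span. -/
def Span.toHom {S T : Lindner O} (P : Span O S.set T.set) : S ⟶ T := Quotient.mk _ P

theorem Span.toHom_surjective {S T : Lindner O} (f : S ⟶ T) :
    ∃ P : Span O S.set T.set, P.toHom = f := Quotient.exists_rep f

theorem Span.toHom_comp {S T R : Lindner O} (P : Span O S.set T.set) (Q : Span O T.set R.set) :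
    P.toHom ≫ Q.toHom = (P.comp Q).toHom := rfl

theorem Span.toHom_id (S : Lindner O) : 𝟙 S = (Span.id S.set).toHom := rfl

theorem Span.toHom_eq {S T : Lindner O} {P Q : Span O S.set T.set} (h : P.Iso Q) :
    P.toHom = Q.toHom := Quotient.sound h

variable (O) in
/-- The span `S ←f- T =id= T`: restriction along `f`. -/
def backSpan {S T : FinGSet G} (f : T →[G] S) : Span O S T :=
  ⟨T, f, MulActionHom.id G, fun _ => O.refl _⟩

/-- The span `S =id= S -f→ T`: transfer along an admissible `f`. -/
def fwdSpan {S T : FinGSet G} (f : S →[G] T) (hf : IsAdmissible O f) : Span O S T :=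
  ⟨S, MulActionHom.id G, f, hf⟩

/-- Restriction along `f : T → S`, as a morphism `S ⟶ T` in the Lindner category. -/
def back {S T : Lindner O} (f : T.set →[G] S.set) : S ⟶ T := (backSpan O f).toHom

/-- Transfer along an admissible `f : S → T`, as a morphism `S ⟶ T` in the Lindner category. -/
def fwd {S T : Lindner O} (f : S.set →[G] T.set) (hf : IsAdmissible O f) : S ⟶ T :=
  (fwdSpan f hf).toHom

theorem Span.toHom_eq_back_fwd {S T : Lindner O} (P : Span O S.set T.set) :
    P.toHom = back (T := ⟨P.apex⟩) P.left ≫ fwd (S := ⟨P.apex⟩) P.right P.admissible := by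
  refine Span.toHom_eq ⟨⟨fun x => ⟨(x, x), rfl⟩, fun _ _ => rfl⟩, ⟨?_, ?_⟩, fun _ => rfl,
    fun _ => rfl⟩
  · intro a b h
    exact congrArg (fun p => p.1.1) h
  · rintro ⟨⟨a, b⟩, h⟩
    have h : a = b := h
    subst h
    exact ⟨a, rfl⟩

theorem back_comp_back {S T R : Lindner O} (f : T.set →[G] S.set) (h : R.set →[G] T.set) :
    back f ≫ back h = (back (f.comp h) : S ⟶ R) := by
  refine Span.toHom_eq ⟨⟨fun p => p.1.2, fun _ _ => rfl⟩, ⟨?_, ?_⟩, ?_, fun _ => rfl⟩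
  · rintro ⟨⟨a, b⟩, k⟩ ⟨⟨a', b'⟩, k'⟩ (e : b = b')
    subst e
    have k : a = h b := k
    have k' : a' = h b := k'
    exact Subtype.ext (Prod.ext (k.trans k'.symm) rfl)
  · intro x
    exact ⟨⟨(h x, x), rfl⟩, rfl⟩
  · rintro ⟨⟨a, b⟩, k⟩
    have k : a = h b := k
    subst k
    rfl

theorem back_id (S : Lindner O) : back (MulActionHom.id G) = 𝟙 S := rfl

/-- A bijective `G`-map gives an isomorphism in the Lindner category. -/
noncomputable def isoOfBijective {S T : Lindner O} (f : T.set →[G] S.set) (hf : Function.Bijective f) : S ≅ T where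
  hom := back f
  inv := back (f.inverse (Equiv.ofBijective f hf).symm (Equiv.ofBijective f hf).left_inv
    (Equiv.ofBijective f hf).right_inv)
  hom_inv_id := by
    rw [back_comp_back, ← back_id]
    congr 1
    ext x
    exact (Equiv.ofBijective f hf).apply_symm_apply x
  inv_hom_id := by
    rw [back_comp_back, ← back_id]
    congr 1
    ext x
    exact (Equiv.ofBijective f hf).symm_apply_apply x


/-! ### Biproducts in the Lindner category -/

theorem FinGSet.isEmpty_empty : IsEmpty (FinGSet.empty G) := inferInstanceAs (IsEmpty PEmpty)

/-- The span with empty apex. -/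
def zeroSpan (O : TransferSystem G) (S T : FinGSet G) : Span O S T where
  apex := FinGSet.empty G
  left := ⟨fun x => PEmpty.elim x, fun _ x => PEmpty.elim x⟩
  right := ⟨fun x => PEmpty.elim x, fun _ x => PEmpty.elim x⟩
  admissible := fun x => PEmpty.elim x

theorem Span.iso_of_isEmpty {S T : FinGSet G} (P Q : Span O S T) (hP : IsEmpty P.apex)
    (hQ : IsEmpty Q.apex) : P.Iso Q :=
  ⟨⟨fun x => hP.elim x, fun _ x => hP.elim x⟩, ⟨fun x => hP.elim x, fun x => hQ.elim x⟩,
    fun x => hP.elim x, fun x => hP.elim x⟩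

theorem isEmpty_zeroSpan (S T : FinGSet G) : IsEmpty (zeroSpan O S T).apex :=
  FinGSet.isEmpty_empty

instance : HasZeroMorphisms (Lindner O) where
  zero S T := ⟨(zeroSpan O S.set T.set).toHom⟩
  comp_zero f R := by
    obtain ⟨P, rfl⟩ := Span.toHom_surjective f
    exact Span.toHom_eq (Span.iso_of_isEmpty _ _ ⟨fun p => PEmpty.elim p.1.2⟩
      (isEmpty_zeroSpan _ _))
  zero_comp S T R f := by
    obtain ⟨P, rfl⟩ := Span.toHom_surjective f
    exact Span.toHom_eq (Span.iso_of_isEmpty _ _ ⟨fun p => PEmpty.elim p.1.1⟩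
      (isEmpty_zeroSpan _ _))

theorem Span.toHom_eq_zero {S T : Lindner O} (P : Span O S.set T.set) (hP : IsEmpty P.apex) :
    P.toHom = 0 :=
  Span.toHom_eq (Span.iso_of_isEmpty _ _ hP (isEmpty_zeroSpan _ _))

theorem isZero_of_isEmpty (S : Lindner O) (hS : IsEmpty S.set) : IsZero S := by
  rw [IsZero.iff_id_eq_zero, Span.toHom_id]
  exact Span.toHom_eq_zero _ hS

instance : HasZeroObject (Lindner O) :=
  ⟨⟨FinGSet.empty G⟩, isZero_of_isEmpty _ FinGSet.isEmpty_empty⟩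

/-- The first inclusion into a disjoint union. -/
def inlMap (S T : FinGSet G) : S →[G] S.sum T := ⟨Sum.inl, fun _ _ => rfl⟩

/-- The second inclusion into a disjoint union. -/
def inrMap (S T : FinGSet G) : T →[G] S.sum T := ⟨Sum.inr, fun _ _ => rfl⟩

theorem inlMap_injective (S T : FinGSet G) : Function.Injective (inlMap S T) := Sum.inl_injective

theorem inrMap_injective (S T : FinGSet G) : Function.Injective (inrMap S T) := Sum.inr_injective

theorem isAdmissible_of_injective {S T : FinGSet G} (f : S →[G] T) (hf : Function.Injective f) :
    IsAdmissible O f := by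
  intro s
  have : stabilizer G (f s) = stabilizer G s := by
    ext g
    rw [mem_stabilizer_iff, mem_stabilizer_iff, ← map_smul, hf.eq_iff]
  rw [this]
  exact O.refl _

theorem back_fwd_of_injective {S T : Lindner O} (f : S.set →[G] T.set)
    (hf : Function.Injective f) : fwd f (isAdmissible_of_injective f hf) ≫ back f = 𝟙 S := by
  refine Span.toHom_eq ⟨⟨fun p => p.1.1, fun _ _ => rfl⟩, ⟨?_, fun x => ⟨⟨(x, x), rfl⟩, rfl⟩⟩,
    fun _ => rfl, fun p => hf p.2⟩
  rintro ⟨⟨a, b⟩, h⟩ ⟨⟨a', b'⟩, h'⟩ (e : a = a')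
  subst e
  have h : a = b := hf h
  have h' : a = b' := hf h'
  subst h
  subst h'
  rfl

theorem stabilizer_inlMap {S T : FinGSet G} (s : S) :
    stabilizer G (inlMap S T s) = stabilizer G s := by
  ext g
  rw [mem_stabilizer_iff, mem_stabilizer_iff, ← map_smul, (inlMap_injective S T).eq_iff]

theorem stabilizer_inrMap {S T : FinGSet G} (t : T) :
    stabilizer G (inrMap S T t) = stabilizer G t := by
  ext g
  rw [mem_stabilizer_iff, mem_stabilizer_iff, ← map_smul, (inrMap_injective S T).eq_iff]

/-- The disjoint union in the Lindner category. -/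
def Lindner.sum (S T : Lindner O) : Lindner O := ⟨S.set.sum T.set⟩

variable (S T : Lindner O)

/-- The first inclusion. -/
def sumInl : S ⟶ S.sum T :=
  fwd (inlMap S.set T.set) (isAdmissible_of_injective _ (inlMap_injective _ _))

/-- The second inclusion. -/
def sumInr : T ⟶ S.sum T :=
  fwd (inrMap S.set T.set) (isAdmissible_of_injective _ (inrMap_injective _ _))

/-- The first projection. -/
def sumFst : S.sum T ⟶ S := back (inlMap S.set T.set)

/-- The second projection. -/
def sumSnd : S.sum T ⟶ T := back (inrMap S.set T.set)

theorem sumInl_sumFst : sumInl S T ≫ sumFst S T = 𝟙 S :=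
  back_fwd_of_injective _ (inlMap_injective _ _)

theorem sumInr_sumSnd : sumInr S T ≫ sumSnd S T = 𝟙 T :=
  back_fwd_of_injective _ (inrMap_injective _ _)

theorem sumInl_sumSnd : sumInl S T ≫ sumSnd S T = 0 :=
  Span.toHom_eq_zero _ ⟨fun p => Sum.inl_ne_inr p.2⟩

theorem sumInr_sumFst : sumInr S T ≫ sumFst S T = 0 :=
  Span.toHom_eq_zero _ ⟨fun p => Sum.inr_ne_inl p.2⟩

variable {S T}

/-- The span into a disjoint union given by two spans. -/
def Span.lift {R S T : FinGSet G} (P : Span O R S) (Q : Span O R T) : Span O R (S.sum T) where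
  apex := P.apex.sum Q.apex
  left := ⟨Sum.elim P.left Q.left, by
    rintro g (x | x)
    exacts [map_smul P.left g x, map_smul Q.left g x]⟩
  right := ⟨Sum.map P.right Q.right, by
    rintro g (x | x)
    exacts [congrArg Sum.inl (map_smul P.right g x), congrArg Sum.inr (map_smul Q.right g x)]⟩
  admissible := by
    rintro (x | x)
    · have := P.admissible x
      rw [← stabilizer_inlMap (T := Q.apex), ← stabilizer_inlMap (T := T) (P.right x)] at this
      exact this
    · have := Q.admissible x
      rw [← stabilizer_inrMap (S := P.apex), ← stabilizer_inrMap (S := S) (Q.right x)] at this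
      exact this

/-- The span out of a disjoint union given by two spans. -/
def Span.desc {R S T : FinGSet G} (P : Span O S R) (Q : Span O T R) : Span O (S.sum T) R where
  apex := P.apex.sum Q.apex
  left := ⟨Sum.map P.left Q.left, by
    rintro g (x | x)
    exacts [congrArg Sum.inl (map_smul P.left g x), congrArg Sum.inr (map_smul Q.left g x)]⟩
  right := ⟨Sum.elim P.right Q.right, by
    rintro g (x | x)
    exacts [map_smul P.right g x, map_smul Q.right g x]⟩
  admissible := by
    rintro (x | x)
    · have := P.admissible x
      rw [← stabilizer_inlMap (T := Q.apex)] at this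
      exact this
    · have := Q.admissible x
      rw [← stabilizer_inrMap (S := P.apex)] at this
      exact this

theorem exists_lift {R : Lindner O} (f : R ⟶ S) (g : R ⟶ T) :
    ∃ h : R ⟶ S.sum T, h ≫ sumFst S T = f ∧ h ≫ sumSnd S T = g := by
  obtain ⟨P, rfl⟩ := Span.toHom_surjective f
  obtain ⟨Q, rfl⟩ := Span.toHom_surjective g
  refine ⟨Span.toHom (P.lift Q), Eq.symm (Span.toHom_eq ?_), Eq.symm (Span.toHom_eq ?_)⟩
  · refine ⟨⟨fun x => ⟨(Sum.inl x, P.right x), rfl⟩, fun g x => ?_⟩, ⟨fun a b h => ?_, ?_⟩,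
      fun _ => rfl, fun _ => rfl⟩
    · exact Subtype.ext (Prod.ext rfl (map_smul P.right g x))
    · exact Sum.inl_injective (congrArg (fun p => p.1.1) h)
    · rintro ⟨⟨x | x, s⟩, h⟩
      · have h : P.right x = s := Sum.inl_injective h
        subst h
        exact ⟨x, rfl⟩
      · exact absurd h Sum.inr_ne_inl
  · refine ⟨⟨fun x => ⟨(Sum.inr x, Q.right x), rfl⟩, fun g x => ?_⟩, ⟨fun a b h => ?_, ?_⟩,
      fun _ => rfl, fun _ => rfl⟩
    · exact Subtype.ext (Prod.ext rfl (map_smul Q.right g x))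
    · exact Sum.inr_injective (congrArg (fun p => p.1.1) h)
    · rintro ⟨⟨x | x, s⟩, h⟩
      · exact absurd h Sum.inl_ne_inr
      · have h : Q.right x = s := Sum.inr_injective h
        subst h
        exact ⟨x, rfl⟩

theorem exists_desc {R : Lindner O} (f : S ⟶ R) (g : T ⟶ R) :
    ∃ h : S.sum T ⟶ R, sumInl S T ≫ h = f ∧ sumInr S T ≫ h = g := by
  obtain ⟨P, rfl⟩ := Span.toHom_surjective f
  obtain ⟨Q, rfl⟩ := Span.toHom_surjective g
  refine ⟨Span.toHom (P.desc Q), Eq.symm (Span.toHom_eq ?_), Eq.symm (Span.toHom_eq ?_)⟩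
  · refine ⟨⟨fun x => ⟨(P.left x, Sum.inl x), rfl⟩, fun g x => ?_⟩, ⟨fun a b h => ?_, ?_⟩,
      fun _ => rfl, fun _ => rfl⟩
    · exact Subtype.ext (Prod.ext (map_smul P.left g x) rfl)
    · exact Sum.inl_injective (congrArg (fun p => p.1.2) h)
    · rintro ⟨⟨s, x | x⟩, h⟩
      · have h : s = P.left x := Sum.inl_injective h
        subst h
        exact ⟨x, rfl⟩
      · exact absurd h Sum.inl_ne_inr
  · refine ⟨⟨fun x => ⟨(Q.left x, Sum.inr x), rfl⟩, fun g x => ?_⟩, ⟨fun a b h => ?_, ?_⟩,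
      fun _ => rfl, fun _ => rfl⟩
    · exact Subtype.ext (Prod.ext (map_smul Q.left g x) rfl)
    · exact Sum.inr_injective (congrArg (fun p => p.1.2) h)
    · rintro ⟨⟨s, x | x⟩, h⟩
      · exact absurd h Sum.inr_ne_inl
      · have h : s = Q.left x := Sum.inr_injective h
        subst h
        exact ⟨x, rfl⟩

theorem eq_lift {R S T : FinGSet G} (P : Span O R (S.sum T)) :
    ((P.comp (backSpan O (inlMap S T))).lift (P.comp (backSpan O (inrMap S T)))).Iso P := by
  refine ⟨⟨Sum.elim (fun p => p.1.1) (fun p => p.1.1), ?_⟩, ⟨?_, ?_⟩, ?_, ?_⟩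
  · rintro g (x | x) <;> rfl
  · rintro (⟨⟨a, b⟩, h⟩ | ⟨⟨a, b⟩, h⟩) (⟨⟨a', b'⟩, h'⟩ | ⟨⟨a', b'⟩, h'⟩) (e : a = a')
    · subst e
      exact congrArg Sum.inl (Subtype.ext (Prod.ext rfl (Sum.inl_injective (h.symm.trans h'))))
    · subst e
      exact absurd (h.symm.trans h') Sum.inl_ne_inr
    · subst e
      exact absurd (h.symm.trans h') Sum.inr_ne_inl
    · subst e
      exact congrArg Sum.inr (Subtype.ext (Prod.ext rfl (Sum.inr_injective (h.symm.trans h'))))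
  · intro x
    rcases h : P.right x with s | t
    · exact ⟨Sum.inl ⟨(x, s), h⟩, rfl⟩
    · exact ⟨Sum.inr ⟨(x, t), h⟩, rfl⟩
  · rintro (x | x) <;> rfl
  · rintro (x | x)
    exacts [x.2, x.2]

theorem eq_desc {R S T : FinGSet G} (P : Span O (S.sum T) R) :
    (((fwdSpan (O := O) (inlMap S T) (isAdmissible_of_injective _ (inlMap_injective _ _))).comp
      P).desc ((fwdSpan (inrMap S T) (isAdmissible_of_injective _ (inrMap_injective _ _))).comp
      P)).Iso P := by
  refine ⟨⟨Sum.elim (fun p => p.1.2) (fun p => p.1.2), ?_⟩, ⟨?_, ?_⟩, ?_, ?_⟩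
  · rintro g (x | x) <;> rfl
  · rintro (⟨⟨b, a⟩, h⟩ | ⟨⟨b, a⟩, h⟩) (⟨⟨b', a'⟩, h'⟩ | ⟨⟨b', a'⟩, h'⟩) (e : a = a')
    · subst e
      exact congrArg Sum.inl (Subtype.ext (Prod.ext (Sum.inl_injective (h.trans h'.symm)) rfl))
    · subst e
      exact absurd (h.trans h'.symm) Sum.inl_ne_inr
    · subst e
      exact absurd (h.trans h'.symm) Sum.inr_ne_inl
    · subst e
      exact congrArg Sum.inr (Subtype.ext (Prod.ext (Sum.inr_injective (h.trans h'.symm)) rfl))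
  · intro x
    rcases h : P.left x with s | t
    · exact ⟨Sum.inl ⟨(s, x), h.symm⟩, rfl⟩
    · exact ⟨Sum.inr ⟨(t, x), h.symm⟩, rfl⟩
  · rintro (x | x)
    exacts [x.2.symm, x.2.symm]
  · rintro (x | x) <;> rfl

theorem lift_congr {R S T : FinGSet G} {P P' : Span O R S} {Q Q' : Span O R T} (h : P.Iso P')
    (k : Q.Iso Q') : (P.lift Q).Iso (P'.lift Q') := by
  obtain ⟨e, he, hl, hr⟩ := h
  obtain ⟨f, hf, hl', hr'⟩ := k
  refine ⟨⟨Sum.map e f, ?_⟩, he.sumMap hf, ?_, ?_⟩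
  · rintro g (x | x)
    exacts [congrArg Sum.inl (map_smul e g x), congrArg Sum.inr (map_smul f g x)]
  · rintro (x | x)
    exacts [hl x, hl' x]
  · rintro (x | x)
    exacts [congrArg Sum.inl (hr x), congrArg Sum.inr (hr' x)]

theorem desc_congr {R S T : FinGSet G} {P P' : Span O S R} {Q Q' : Span O T R} (h : P.Iso P')
    (k : Q.Iso Q') : (P.desc Q).Iso (P'.desc Q') := by
  obtain ⟨e, he, hl, hr⟩ := h
  obtain ⟨f, hf, hl', hr'⟩ := k
  refine ⟨⟨Sum.map e f, ?_⟩, he.sumMap hf, ?_, ?_⟩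
  · rintro g (x | x)
    exacts [congrArg Sum.inl (map_smul e g x), congrArg Sum.inr (map_smul f g x)]
  · rintro (x | x)
    exacts [congrArg Sum.inl (hl x), congrArg Sum.inr (hl' x)]
  · rintro (x | x)
    exacts [hr x, hr' x]

theorem sum_hom_ext {R : Lindner O} {f g : R ⟶ S.sum T} (h : f ≫ sumFst S T = g ≫ sumFst S T)
    (k : f ≫ sumSnd S T = g ≫ sumSnd S T) : f = g := by
  obtain ⟨P, rfl⟩ := Span.toHom_surjective f
  obtain ⟨Q, rfl⟩ := Span.toHom_surjective g
  let e := fun (X Y : FinGSet G) => (spanSetoid O X Y).iseqv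
  exact Span.toHom_eq ((e _ _).trans ((e _ _).symm (eq_lift P))
    ((e _ _).trans (lift_congr (Quotient.exact h) (Quotient.exact k)) (eq_lift Q)))

theorem sum_hom_ext' {R : Lindner O} {f g : S.sum T ⟶ R} (h : sumInl S T ≫ f = sumInl S T ≫ g)
    (k : sumInr S T ≫ f = sumInr S T ≫ g) : f = g := by
  obtain ⟨P, rfl⟩ := Span.toHom_surjective f
  obtain ⟨Q, rfl⟩ := Span.toHom_surjective g
  let e := fun (X Y : FinGSet G) => (spanSetoid O X Y).iseqv
  exact Span.toHom_eq ((e _ _).trans ((e _ _).symm (eq_desc P))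
    ((e _ _).trans (desc_congr (Quotient.exact h) (Quotient.exact k)) (eq_desc Q)))

end Lindner

/-- A criterion for a binary bicone to be a bilimit. -/
theorem isBilimit_of_exists {C : Type*} [Category* C] [HasZeroMorphisms C] {X Y : C}
    (b : BinaryBicone X Y)
    (h1 : ∀ {Z : C} (f : Z ⟶ X) (g : Z ⟶ Y), ∃ h : Z ⟶ b.pt, h ≫ b.fst = f ∧ h ≫ b.snd = g)
    (h2 : ∀ {Z : C} {f g : Z ⟶ b.pt}, f ≫ b.fst = g ≫ b.fst → f ≫ b.snd = g ≫ b.snd → f = g)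
    (h3 : ∀ {Z : C} (f : X ⟶ Z) (g : Y ⟶ Z), ∃ h : b.pt ⟶ Z, b.inl ≫ h = f ∧ b.inr ≫ h = g)
    (h4 : ∀ {Z : C} {f g : b.pt ⟶ Z}, b.inl ≫ f = b.inl ≫ g → b.inr ≫ f = b.inr ≫ g → f = g) :
    Nonempty b.IsBilimit := by
  choose l hl hr using @h1
  choose d hd hd' using @h3
  exact ⟨⟨BinaryFan.isLimitMk (fun s => l s.fst s.snd) (fun s => hl _ _) (fun s => hr _ _)
      (fun s m e1 e2 => h2 (e1.trans (hl _ _).symm) (e2.trans (hr _ _).symm)),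
    BinaryCofan.isColimitMk (fun s => d s.inl s.inr) (fun s => hd _ _) (fun s => hd' _ _)
      (fun s m e1 e2 => h4 (e1.trans (hd _ _).symm) (e2.trans (hd' _ _).symm))⟩⟩

section Lindner

variable {G : Type u} [Group G] {O : TransferSystem G}

/-- The disjoint union as a bicone. -/
def sumBicone (S T : Lindner O) : BinaryBicone S T where
  pt := S.sum T
  fst := sumFst S T
  snd := sumSnd S T
  inl := sumInl S T
  inr := sumInr S T
  inl_fst := sumInl_sumFst S T
  inl_snd := sumInl_sumSnd S T
  inr_fst := sumInr_sumFst S T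
  inr_snd := sumInr_sumSnd S T

/-- The disjoint union is the biproduct. -/
theorem sumBicone_isBilimit (S T : Lindner O) : Nonempty (sumBicone S T).IsBilimit :=
  isBilimit_of_exists _ exists_lift sum_hom_ext exists_desc sum_hom_ext'

instance : HasBinaryBiproducts (Lindner O) :=
  ⟨fun S T => .mk ⟨sumBicone S T, (sumBicone_isBilimit S T).some⟩⟩

instance : HasFiniteProducts (Lindner O) := hasFiniteProducts_of_has_binary_and_terminal

/-- The property of a finite `G`-set that every stabilizer is subconjugate to `H`. -/
def familyProp (O : TransferSystem G) (H : Subgroup G) : ObjectProperty (Lindner O) :=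
  fun T => ∀ t : T.set, IsSubconj (stabilizer G t) H

/-- The full subcategory `A^O_(H)` of the Lindner category on the finite `G`-sets all of whose
stabilizers are subconjugate to `H`. -/
abbrev FamilyLindner (O : TransferSystem G) (H : Subgroup G) : Type (u + 1) :=
  (familyProp O H).FullSubcategory

variable {H : Subgroup G}

theorem familyProp_sum {S T : Lindner O} (hS : familyProp O H S) (hT : familyProp O H T) :
    familyProp O H (S.sum T) := by
  rintro (x | x)
  · have := hS x
    rw [← stabilizer_inlMap (T := T.set)] at this
    exact this
  · have := hT x
    rw [← stabilizer_inrMap (S := S.set)] at this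
    exact this

/-- The disjoint union as a bicone in `A^O_(H)`. -/
def familySumBicone (S T : FamilyLindner O H) : BinaryBicone S T where
  pt := ⟨S.obj.sum T.obj, familyProp_sum S.property T.property⟩
  fst := ⟨sumFst S.obj T.obj⟩
  snd := ⟨sumSnd S.obj T.obj⟩
  inl := ⟨sumInl S.obj T.obj⟩
  inr := ⟨sumInr S.obj T.obj⟩
  inl_fst := ObjectProperty.hom_ext _ (sumInl_sumFst S.obj T.obj)
  inl_snd := ObjectProperty.hom_ext _ (sumInl_sumSnd S.obj T.obj)
  inr_fst := ObjectProperty.hom_ext _ (sumInr_sumFst S.obj T.obj)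
  inr_snd := ObjectProperty.hom_ext _ (sumInr_sumSnd S.obj T.obj)

theorem familySumBicone_isBilimit (S T : FamilyLindner O H) :
    Nonempty (familySumBicone S T).IsBilimit := by
  apply isBilimit_of_exists
  · intro Z f g
    obtain ⟨h, h1, h2⟩ := exists_lift f.hom g.hom
    exact ⟨⟨h⟩, ObjectProperty.hom_ext _ h1, ObjectProperty.hom_ext _ h2⟩
  · intro Z f g h k
    exact ObjectProperty.hom_ext _
      (sum_hom_ext (congrArg (fun p => p.hom) h) (congrArg (fun p => p.hom) k))
  · intro Z f g
    obtain ⟨h, h1, h2⟩ := exists_desc f.hom g.hom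
    exact ⟨⟨h⟩, ObjectProperty.hom_ext _ h1, ObjectProperty.hom_ext _ h2⟩
  · intro Z f g h k
    exact ObjectProperty.hom_ext _
      (sum_hom_ext' (congrArg (fun p => p.hom) h) (congrArg (fun p => p.hom) k))

instance : HasBinaryBiproducts (FamilyLindner O H) :=
  ⟨fun S T => .mk ⟨familySumBicone S T, (familySumBicone_isBilimit S T).some⟩⟩

theorem family_isZero_of_isEmpty (S : FamilyLindner O H) (hS : IsEmpty S.obj.set) : IsZero S := by
  rw [IsZero.iff_id_eq_zero]
  exact ObjectProperty.hom_ext _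
    ((IsZero.iff_id_eq_zero _).1 (isZero_of_isEmpty S.obj hS))

instance : HasZeroObject (FamilyLindner O H) :=
  ⟨⟨⟨FinGSet.empty G⟩, fun x => PEmpty.elim x⟩, family_isZero_of_isEmpty _ FinGSet.isEmpty_empty⟩

instance : HasFiniteProducts (FamilyLindner O H) := hasFiniteProducts_of_has_binary_and_terminal

end Lindner

/-! ### Smallness of the Lindner category -/

section Small

variable {G : Type u} [Group G] {O : TransferSystem G}

/-- A finite `G`-set with underlying set `Fin n`. -/
def stdSet (G : Type u) [Group G] (p : Σ n : ℕ, MulAction G (Fin n)) : FinGSet G where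
  carrier := ULift.{u} (Fin p.1)
  action :=
    letI := p.2
    inferInstance

theorem exists_stdSet (S : FinGSet G) : ∃ p, ∃ e : (stdSet G p) →[G] S, Function.Bijective e := by
  obtain ⟨n, ⟨e⟩⟩ := Finite.exists_equiv_fin S
  let a : MulAction G (Fin n) := e.symm.mulAction G
  refine ⟨⟨n, a⟩, ⟨fun x => e.symm x.down, fun g x => ?_⟩, e.symm.bijective.comp
    Equiv.ulift.bijective⟩
  exact e.symm_apply_apply _

instance countable_stdSet [Finite G] : Countable (Σ n : ℕ, MulAction G (Fin n)) := by
  have : ∀ n, Countable (MulAction G (Fin n)) := fun n =>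
    Function.Injective.countable (f := fun a : MulAction G (Fin n) => a.toSMul.smul)
      (fun a b h => by
        ext g x
        exact congrArg Fin.val (congrFun (congrFun h g) x))
  infer_instance

instance countable_hom [Finite G] (S T : Lindner O) : Countable (S ⟶ T) := by
  let D := Σ p : (Σ n : ℕ, MulAction G (Fin n)),
    {q : (stdSet G p → S.set) × (stdSet G p → T.set) //
      ∃ P : Span O S.set T.set, ∃ h : P.apex = stdSet G p,
        (∀ x, P.left x = q.1 (h ▸ x)) ∧ ∀ x, P.right x = q.2 (h ▸ x)}
  have hc : ∀ p : (Σ n : ℕ, MulAction G (Fin n)),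
    Countable ((stdSet G p → S.set) × (stdSet G p → T.set)) := fun p => inferInstance
  have : Countable D := inferInstance
  refine Function.Surjective.countable (f := fun d : D => (d.2.2.choose).toHom) fun f => ?_
  obtain ⟨P, rfl⟩ := Span.toHom_surjective f
  obtain ⟨p, e, he⟩ := exists_stdSet P.apex
  let P' : Span O S.set T.set := ⟨stdSet G p, P.left.comp e, P.right.comp e, fun x =>
    O.trans (isAdmissible_of_injective e he.1 x) (P.admissible (e x))⟩
  let d : D := ⟨p, (P'.left, P'.right), P', rfl, fun _ => rfl, fun _ => rfl⟩
  refine ⟨d, ?_⟩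
  obtain ⟨h, hl, hr⟩ := d.2.2.choose_spec
  have : d.2.2.choose.Iso P' := by
    generalize d.2.2.choose = Q at h hl hr
    obtain ⟨A, l, r, hQ⟩ := Q
    dsimp only at h
    subst h
    exact ⟨MulActionHom.id G, Function.bijective_id, fun x => (hl x).symm, fun x => (hr x).symm⟩
  exact (Span.toHom_eq this).trans (Span.toHom_eq ⟨e, he, fun _ => rfl, fun _ => rfl⟩)

instance locallySmall_lindner [Finite G] : LocallySmall.{v} (Lindner O) :=
  ⟨fun S T => Countable.toSmall.{v} (S ⟶ T)⟩

instance essentiallySmall_lindner [Finite G] : EssentiallySmall.{v} (Lindner O) := by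
  rw [essentiallySmall_iff]
  refine ⟨?_, inferInstance⟩
  have : Countable (Skeleton (Lindner O)) := by
    refine Function.Surjective.countable
      (f := fun p : (Σ n : ℕ, MulAction G (Fin n)) => toSkeleton (⟨stdSet G p⟩ : Lindner O)) ?_
    intro X
    obtain ⟨p, e, he⟩ := exists_stdSet ((fromSkeleton _).obj X).set
    refine ⟨p, ?_⟩
    have i : (⟨stdSet G p⟩ : Lindner O) ≅ (fromSkeleton _).obj X := (isoOfBijective e he).symm
    exact toSkeleton_eq_iff.2 ⟨i⟩
  exact Countable.toSmall _

instance essentiallySmall_family [Finite G] (H : Subgroup G) :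
    EssentiallySmall.{v} (FamilyLindner O H) :=
  essentiallySmall_of_fully_faithful (familyProp O H).ι

end Small

/-! ### Kan extensions of product preserving functors -/

section Kan

variable {C D A : Type*} [Category* C] [Category* D] [Category* A]
  [HasZeroMorphisms C] [HasBinaryBiproducts C] [HasZeroObject C] [HasFiniteProducts C]
  [HasZeroMorphisms D] [HasBinaryBiproducts D] [HasZeroObject D] [HasFiniteProducts D]
  [Preadditive A] [HasZeroObject A]

set_option linter.unusedSectionVars false

theorem preservesZero_of_finiteProducts (F : C ⥤ A) [PreservesFiniteProducts F] :
    F.PreservesZeroMorphisms := by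
  have := PreservesFiniteProducts.preserves (F := F) 0
  have : PreservesLimit (Functor.empty.{0} C) F := inferInstance
  infer_instance

theorem total_of_finiteProducts (F : C ⥤ A) [PreservesFiniteProducts F] (X Y : C) :
    F.map (biprod.fst ≫ biprod.inl : X ⊞ Y ⟶ X ⊞ Y) + F.map (biprod.snd ≫ biprod.inr) = 𝟙 _ := by
  have := preservesZero_of_finiteProducts F
  have h := isLimitOfPreserves F (BinaryBiproduct.isLimit X Y)
  have h' := (isLimitMapConeBinaryFanEquiv F _ _) h
  apply BinaryFan.IsLimit.hom_ext h'
  · change _ ≫ F.map biprod.fst = _ ≫ F.map biprod.fst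
    rw [Preadditive.add_comp, ← F.map_comp, ← F.map_comp, Category.assoc, Category.assoc,
      biprod.inl_fst, biprod.inr_fst, Category.comp_id, comp_zero, F.map_zero, add_zero,
      Category.id_comp]
  · change _ ≫ F.map biprod.snd = _ ≫ F.map biprod.snd
    rw [Preadditive.add_comp, ← F.map_comp, ← F.map_comp, Category.assoc, Category.assoc,
      biprod.inl_snd, biprod.inr_snd, Category.comp_id, comp_zero, F.map_zero, zero_add,
      Category.id_comp]

theorem finiteProducts_of_total (F : C ⥤ A) (h0 : ∀ X Y : C, F.map (0 : X ⟶ Y) = 0)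
    (h : ∀ X Y : C, F.map (biprod.fst ≫ biprod.inl : X ⊞ Y ⟶ X ⊞ Y) +
      F.map (biprod.snd ≫ biprod.inr) = 𝟙 _) : PreservesFiniteProducts F := by
  have : F.PreservesZeroMorphisms := ⟨h0⟩
  have := Functor.preservesTerminalObject_of_preservesZeroMorphisms F
  have : PreservesLimitsOfShape (Discrete.{0} PEmpty) F :=
    preservesLimitsOfShape_pempty_of_preservesTerminal F
  have : PreservesLimitsOfShape (Discrete WalkingPair) F := by
    have : ∀ X Y : C, PreservesLimit (pair X Y) F := fun X Y => by
      refine preservesLimit_of_preserves_limit_cone (BinaryBiproduct.isLimit X Y) ?_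
      refine (isLimitMapConeBinaryFanEquiv F _ _).symm ?_
      let b : BinaryBicone (F.obj X) (F.obj Y) :=
        { pt := F.obj (X ⊞ Y)
          fst := F.map biprod.fst
          snd := F.map biprod.snd
          inl := F.map biprod.inl
          inr := F.map biprod.inr
          inl_fst := by simp [← F.map_comp]
          inl_snd := by simp [← F.map_comp]
          inr_fst := by simp [← F.map_comp]
          inr_snd := by simp [← F.map_comp] }
      exact (isBinaryBilimitOfTotal b (by simpa using h X Y)).isLimit
    exact ⟨fun {K} => preservesLimit_of_iso_diagram F (diagramIsoPair K).symm⟩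
  exact .of_preserves_binary_and_terminal F

variable (i : C ⥤ D) [i.PreservesZeroMorphisms]

theorem lan_finiteProducts {M : C ⥤ A} [PreservesFiniteProducts M] (E : i.LeftExtension M)
    (hE : E.IsPointwiseLeftKanExtension) : PreservesFiniteProducts E.right := by
  have hM0 := preservesZero_of_finiteProducts M
  have hM := total_of_finiteProducts M
  have nat : ∀ {X Y : C} (f : X ⟶ Y), M.map f ≫ E.hom.app Y = E.hom.app X ≫ E.right.map (i.map f) :=
    fun f => E.hom.naturality f
  apply finiteProducts_of_total
  · intro X Y
    refine (hE X).hom_ext' fun S f => ?_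
    have h1 : E.hom.app S ≫ E.right.map f ≫ E.right.map 0 =
        (M.map (0 : S ⟶ S) ≫ E.hom.app S) ≫ E.right.map (0 : i.obj S ⟶ Y) := by
      rw [nat]
      simp [← Functor.map_comp]
    rw [h1]
    simp
  · intro X Y
    refine (hE _).hom_ext' fun S f => ?_
    rw [Preadditive.comp_add, Preadditive.comp_add, ← Functor.map_comp, ← Functor.map_comp]
    let θ : i.obj (S ⊞ S) ⟶ X ⊞ Y := biprod.lift (i.map biprod.fst ≫ f ≫ biprod.fst)
      (i.map biprod.snd ≫ f ≫ biprod.snd)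
    have e1 : i.map (biprod.lift (𝟙 S) (𝟙 S)) ≫ θ = f := by
      ext <;> simp [θ, ← Functor.map_comp_assoc]
    have e2 : i.map biprod.inl ≫ θ = f ≫ biprod.fst ≫ biprod.inl := by
      ext <;> simp [θ, ← Functor.map_comp_assoc]
    have e3 : i.map biprod.inr ≫ θ = f ≫ biprod.snd ≫ biprod.inr := by
      ext <;> simp [θ, ← Functor.map_comp_assoc]
    have e4 : M.map (biprod.lift (𝟙 S) (𝟙 S)) = M.map biprod.inl + M.map biprod.inr := by
      have := congrArg (fun t => M.map (biprod.lift (𝟙 S) (𝟙 S)) ≫ t) (hM S S)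
      simp only [Preadditive.comp_add, ← Functor.map_comp, biprod.lift_fst_assoc,
        biprod.lift_snd_assoc, Category.id_comp, Category.comp_id] at this
      exact this.symm
    have e5 : E.hom.app S ≫ E.right.map f =
        M.map (biprod.lift (𝟙 S) (𝟙 S)) ≫ E.hom.app (S ⊞ S) ≫ E.right.map θ := by
      rw [← Category.assoc, nat, Category.assoc, ← Functor.map_comp, e1]
    rw [Category.comp_id, e5, e4, Preadditive.add_comp, ← Category.assoc (M.map biprod.inl),
      ← Category.assoc (M.map biprod.inr), nat, nat, Category.assoc, Category.assoc,
      ← Functor.map_comp, ← Functor.map_comp, e2, e3]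

theorem ran_finiteProducts {M : C ⥤ A} [PreservesFiniteProducts M] (E : i.RightExtension M)
    (hE : E.IsPointwiseRightKanExtension) : PreservesFiniteProducts E.left := by
  have hM0 := preservesZero_of_finiteProducts M
  have hM := total_of_finiteProducts M
  have nat : ∀ {X Y : C} (f : X ⟶ Y), E.left.map (i.map f) ≫ E.hom.app Y = E.hom.app X ≫ M.map f :=
    fun f => E.hom.naturality f
  apply finiteProducts_of_total
  · intro X Y
    refine (hE Y).hom_ext' fun S f => ?_
    have h1 : (E.left.map (0 : X ⟶ Y) ≫ E.left.map f) ≫ E.hom.app S =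
        E.left.map (0 : X ⟶ i.obj S) ≫ (E.hom.app S ≫ M.map (0 : S ⟶ S)) := by
      rw [← nat]
      simp [← Functor.map_comp, ← Functor.map_comp_assoc]
    rw [← Category.assoc, h1]
    simp
  · intro X Y
    refine (hE _).hom_ext' fun S f => ?_
    rw [Preadditive.add_comp, ← Functor.map_comp_assoc, ← Functor.map_comp_assoc]
    let θ : X ⊞ Y ⟶ i.obj (S ⊞ S) := biprod.desc (biprod.inl ≫ f ≫ i.map biprod.inl)
      (biprod.inr ≫ f ≫ i.map biprod.inr)
    have e1 : θ ≫ i.map (biprod.desc (𝟙 S) (𝟙 S)) = f := by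
      ext <;> simp [θ, ← Functor.map_comp]
    have e2 : θ ≫ i.map biprod.fst = (biprod.fst ≫ biprod.inl) ≫ f := by
      ext <;> simp [θ, ← Functor.map_comp]
    have e3 : θ ≫ i.map biprod.snd = (biprod.snd ≫ biprod.inr) ≫ f := by
      ext <;> simp [θ, ← Functor.map_comp]
    have e4 : M.map (biprod.desc (𝟙 S) (𝟙 S)) = M.map biprod.fst + M.map biprod.snd := by
      have := congrArg (fun t => t ≫ M.map (biprod.desc (𝟙 S) (𝟙 S))) (hM S S)
      simp only [Preadditive.add_comp, ← Functor.map_comp, Category.assoc, biprod.inl_desc,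
        biprod.inr_desc, Category.id_comp, Category.comp_id] at this
      exact this.symm
    have e5 : E.left.map f ≫ E.hom.app S =
        E.left.map θ ≫ E.hom.app (S ⊞ S) ≫ M.map (biprod.desc (𝟙 S) (𝟙 S)) := by
      rw [← nat, ← Category.assoc, ← Functor.map_comp, e1]
    rw [Category.id_comp, e5, e4, Preadditive.comp_add, Preadditive.comp_add, ← nat, ← nat,
      ← Category.assoc, ← Category.assoc, ← Functor.map_comp, ← Functor.map_comp, e2, e3]

end Kan

/-! ### Mackey functors, restriction, induction and coinduction -/

section Mackey

set_option linter.unusedSectionVars false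

variable {G : Type u} [Group G] [Finite G] (O : TransferSystem G) (H : Subgroup G)

/-- The orbit `G/K` as an object of the Lindner category. -/
abbrev orbitObj (K : Subgroup G) : Lindner O := ⟨orbitSet K⟩

theorem stabilizer_orbitSet (K : Subgroup G) (g : G) :
    stabilizer G (g • ((1 : G) : G ⧸ K)) = conj g K := by
  rw [stabilizer_smul, stabilizer_quotient]

theorem exists_stabilizer_orbitSet (K : Subgroup G) (x : orbitSet K) :
    ∃ g : G, stabilizer G x = conj g K := by
  obtain ⟨g, rfl⟩ := QuotientGroup.mk_surjective x
  refine ⟨g, ?_⟩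
  rw [← stabilizer_orbitSet K g]
  change stabilizer G ((g : G ⧸ K)) = stabilizer G (((g * 1 : G)) : G ⧸ K)
  rw [mul_one]

variable {O H} in
theorem familyProp_orbitObj {K : Subgroup G} (hK : IsSubconj K H) :
    familyProp O H (orbitObj O K) := by
  intro x
  obtain ⟨g, hg⟩ := exists_stabilizer_orbitSet K x
  obtain ⟨a, ha⟩ := hK
  refine ⟨g * a, le_of_eq_of_le hg ?_⟩
  rw [conj_mul]
  exact conj_mono ha

/-- The orbit `G/K` as an object of `A^O_(H)`, for `K` subconjugate to `H`. -/
def familyOrbit {K : Subgroup G} (hK : IsSubconj K H) : FamilyLindner O H :=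
  ⟨orbitObj O K, familyProp_orbitObj hK⟩

variable (k : Type) [CommRing k]

/-- The property of being an above-`[H]^O` Mackey functor with values in `k`-modules: a product
preserving functor on the Lindner category that vanishes on `G/K` unless `K ≥ [H]^O`. -/
def IsAboveMackey : ObjectProperty (Lindner O ⥤ ModuleCat.{v} k) := fun M =>
  PreservesFiniteProducts M ∧ ∀ K : Subgroup G, ¬ IsAbove O H K → IsZero (M.obj (orbitObj O K))

/-- The category of `k`-linear `O`-Mackey functors concentrated above `[H]^O`. -/
abbrev AboveMackey := (IsAboveMackey.{u, v} O H k).FullSubcategory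

/-- The property of being an `[H]^O`-Mackey functor with values in `k`-modules: a product
preserving functor on `A^O_(H)` that vanishes on `G/K` unless `K ∈ [H]^O`. -/
def IsClassMackey : ObjectProperty (FamilyLindner O H ⥤ ModuleCat.{v} k) := fun M =>
  PreservesFiniteProducts M ∧ ∀ (K : Subgroup G) (hK : IsSubconj K H), ¬ Inseparable O H K →
    IsZero (M.obj (familyOrbit O H hK))

/-- The category of `k`-linear `[H]^O`-Mackey functors. -/
abbrev ClassMackey := (IsClassMackey.{u, v} O H k).FullSubcategory

/-- The inclusion `A^O_(H) ⥤ A^O`. -/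
abbrev familyIncl : FamilyLindner O H ⥤ Lindner O := (familyProp O H).ι

variable {O H k}

instance familyIncl_preservesZero : (familyIncl O H).PreservesZeroMorphisms := ⟨fun _ _ => rfl⟩

instance familyIncl_preservesFiniteProducts : PreservesFiniteProducts (familyIncl O H) := by
  have := Functor.preservesTerminalObject_of_preservesZeroMorphisms (familyIncl O H)
  have : PreservesLimitsOfShape (Discrete.{0} PEmpty) (familyIncl O H) :=
    preservesLimitsOfShape_pempty_of_preservesTerminal _
  have : PreservesLimitsOfShape (Discrete WalkingPair) (familyIncl O H) := by
    have : ∀ X Y : FamilyLindner O H, PreservesLimit (pair X Y) (familyIncl O H) := fun X Y => by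
      refine preservesLimit_of_preserves_limit_cone (familySumBicone_isBilimit X Y).some.isLimit ?_
      exact (isLimitMapConeBinaryFanEquiv (familyIncl O H) _ _).symm
        (sumBicone_isBilimit X.obj Y.obj).some.isLimit
    exact ⟨fun {K} => preservesLimit_of_iso_diagram _ (diagramIsoPair K).symm⟩
  exact .of_preserves_binary_and_terminal _

theorem isZero_of_orbits {A : Type*} [Category* A] [Preadditive A] [HasZeroObject A]
    (M : FamilyLindner O H ⥤ A) [PreservesFiniteProducts M]
    (hM : ∀ (K : Subgroup G) (hK : IsSubconj K H), ¬ Inseparable O H K →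
      IsZero (M.obj (familyOrbit O H hK)))
    (U : FamilyLindner O H) (hU : ∀ x : U.obj.set, ¬ Inseparable O H (stabilizer G x)) :
    IsZero (M.obj U) := by
  have hM0 := preservesZero_of_finiteProducts M
  induction h : Nat.card U.obj.set using Nat.strong_induction_on generalizing U with
  | _ n ih =>
    subst h
    by_cases hne : IsEmpty U.obj.set
    · exact M.map_isZero (family_isZero_of_isEmpty U hne)
    obtain ⟨x⟩ := not_isEmpty_iff.1 hne
    let c : SubMulAction G U.obj.set :=
      { carrier := (MulAction.orbit G x)ᶜ
        smul_mem' := fun g y hy hy' => hy (by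
          have := mem_orbit_of_mem_orbit g⁻¹ hy'
          rwa [inv_smul_smul] at this) }
    let C : Lindner O := ⟨⟨c⟩⟩
    have stabC : ∀ y : C.set, stabilizer G y = stabilizer G (y.1 : U.obj.set) := fun y => by
      ext g
      rw [mem_stabilizer_iff, mem_stabilizer_iff]
      exact Subtype.ext_iff
    have hC : familyProp O H C := fun y => by rw [stabC]; exact U.property _
    have hx : IsSubconj (stabilizer G x) H := U.property x
    let e : (orbitObj O (stabilizer G x)).set.sum C.set →[G] U.obj.set :=
      ⟨Sum.elim (ofQuotientStabilizer G x) Subtype.val, by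
        rintro g (y | y)
        · exact ofQuotientStabilizer_smul G x g y
        · rfl⟩
    have he : Function.Bijective e := by
      constructor
      · rintro (y | y) (z | z) (hyz : _ = _)
        · exact congrArg _ (injective_ofQuotientStabilizer G x hyz)
        · refine absurd ?_ z.2
          obtain ⟨g, rfl⟩ := QuotientGroup.mk_surjective y
          exact ⟨g, hyz⟩
        · refine absurd ?_ y.2
          obtain ⟨g, rfl⟩ := QuotientGroup.mk_surjective z
          exact ⟨g, hyz.symm⟩
        · exact congrArg _ (Subtype.ext hyz)
      · intro y
        by_cases hy : y ∈ MulAction.orbit G x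
        · obtain ⟨g, rfl⟩ := hy
          exact ⟨Sum.inl (g : G ⧸ _), rfl⟩
        · exact ⟨Sum.inr ⟨y, hy⟩, rfl⟩
    let b := familySumBicone (familyOrbit O H hx) ⟨C, hC⟩
    have i : U ≅ b.pt :=
      ObjectProperty.isoMk _ (isoOfBijective (S := U.obj) (T := (orbitObj O _).sum C) e he)
    have z1 : IsZero (M.obj (familyOrbit O H hx)) := hM _ hx (hU x)
    have z2 : IsZero (M.obj ⟨C, hC⟩) := by
      refine ih _ ?_ ⟨C, hC⟩ (fun y => by rw [stabC]; exact hU _) rfl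
      exact Finite.card_subtype_lt (x := x) (fun h => h (mem_orbit_self x))
    have hl := (isLimitMapConeBinaryFanEquiv M _ _)
      (isLimitOfPreserves M (familySumBicone_isBilimit (familyOrbit O H hx) ⟨C, hC⟩).some.isLimit)
    refine IsZero.of_iso ?_ (M.mapIso i)
    rw [IsZero.iff_id_eq_zero]
    exact BinaryFan.IsLimit.hom_ext hl (z1.eq_of_tgt _ _) (z2.eq_of_tgt _ _)

/-- The restriction of an above-`[H]^O` Mackey functor to `A^O_(H)` is an `[H]^O`-Mackey functor. -/
theorem isClassMackey_restrict (hH : O.rel H ⊤) {M : Lindner O ⥤ ModuleCat.{v} k}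
    (hM : IsAboveMackey.{u, v} O H k M) :
    IsClassMackey.{u, v} O H k (((Functor.whiskeringLeft _ _ _).obj (familyIncl O H)).obj M) := by
  refine ⟨?_, fun K hK h => hM.2 K fun h' => h (inseparable_of_isAbove hH hK h')⟩
  have := hM.1
  exact inferInstanceAs (PreservesFiniteProducts (familyIncl O H ⋙ M))

variable (k) in
/-- The restriction functor from above-`[H]^O` Mackey functors to `[H]^O`-Mackey functors, for
`H → G` in `O`: precomposition with the inclusion `A^O_(H) ⥤ A^O`. -/
def resFunctor (hH : O.rel H ⊤) : AboveMackey.{u, v} O H k ⥤ ClassMackey.{u, v} O H k :=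
  (IsClassMackey.{u, v} O H k).lift
    ((IsAboveMackey.{u, v} O H k).ι ⋙ (Functor.whiskeringLeft _ _ _).obj (familyIncl O H))
    fun M => isClassMackey_restrict hH M.property

instance hasColimits_family (X : Lindner O) :
    HasColimitsOfShape (CostructuredArrow (familyIncl O H) X) (ModuleCat.{v} k) :=
  hasColimitsOfShape_of_essentiallySmall.{v} _ _

instance hasLimits_family (X : Lindner O) :
    HasLimitsOfShape (StructuredArrow X (familyIncl O H)) (ModuleCat.{v} k) :=
  hasLimitsOfShape_of_essentiallySmall.{v} _ _

instance hasPointwiseLan (M : FamilyLindner O H ⥤ ModuleCat.{v} k) :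
    (familyIncl O H).HasPointwiseLeftKanExtension M := fun X =>
  have := hasColimits_family.{u, v} (k := k) (H := H) X
  show HasColimit _ from inferInstance

instance hasPointwiseRan (M : FamilyLindner O H ⥤ ModuleCat.{v} k) :
    (familyIncl O H).HasPointwiseRightKanExtension M := fun X =>
  have := hasLimits_family.{u, v} (k := k) (H := H) X
  show HasLimit _ from inferInstance

instance hasLan (M : FamilyLindner O H ⥤ ModuleCat.{v} k) :
    (familyIncl O H).HasLeftKanExtension M := inferInstance

instance hasRan (M : FamilyLindner O H ⥤ ModuleCat.{v} k) :
    (familyIncl O H).HasRightKanExtension M := inferInstance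

theorem not_inseparable_apex {L : Subgroup G} (hL : ¬ IsAbove O H L) {U : FinGSet G}
    (f : U →[G] orbitSet L) (x : U) : ¬ Inseparable O H (stabilizer G x) := by
  intro h
  obtain ⟨g, hg⟩ := exists_stabilizer_orbitSet L (f x)
  have hle : stabilizer G x ≤ conj g L := by
    rw [← hg]
    intro a ha
    rw [mem_stabilizer_iff] at *
    rw [← map_smul, ha]
  have : IsAbove O H (conj g L) := ⟨_, h, hle⟩
  apply hL
  have := this.conj g⁻¹
  rwa [← conj_mul, inv_mul_cancel, conj_one] at this

theorem familyProp_of_map {U : Lindner O} {S : FamilyLindner O H} (f : U.set →[G] S.obj.set) :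
    familyProp O H U := by
  intro x
  obtain ⟨g, hg⟩ := S.property (f x)
  refine ⟨g, le_trans (fun a ha => ?_) hg⟩
  rw [mem_stabilizer_iff] at *
  rw [← map_smul, ha]

/-- The left Kan extension of an `[H]^O`-Mackey functor is an above-`[H]^O` Mackey functor. -/
theorem isAboveMackey_lan {M : FamilyLindner O H ⥤ ModuleCat.{v} k}
    (hM : IsClassMackey.{u, v} O H k M) :
    IsAboveMackey.{u, v} O H k ((familyIncl O H).lan.obj M) := by
  have := hM.1
  have hE := (familyIncl O H).isPointwiseLeftKanExtensionLeftKanExtensionUnit M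
  refine ⟨lan_finiteProducts _ _ hE, fun L hL => ?_⟩
  change IsZero (((familyIncl O H).leftKanExtension M).obj (orbitObj O L))
  rw [IsZero.iff_id_eq_zero]
  refine (hE (orbitObj O L)).hom_ext' fun S f => ?_
  obtain ⟨P, rfl⟩ := Span.toHom_surjective f
  let U : FamilyLindner O H := ⟨⟨P.apex⟩, familyProp_of_map (S := S) P.left⟩
  have hU : IsZero (M.obj U) := isZero_of_orbits M hM.2 U (not_inseparable_apex hL P.right)
  let l : S ⟶ U := ObjectProperty.homMk (back P.left)
  have nat := ((familyIncl O H).leftKanExtensionUnit M).naturality l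
  have hz : ((familyIncl O H).leftKanExtensionUnit M).app S ≫
      ((familyIncl O H).leftKanExtension M).map P.toHom = 0 := by
    rw [P.toHom_eq_back_fwd, Functor.map_comp]
    have h2 : ((familyIncl O H).leftKanExtensionUnit M).app S ≫
        ((familyIncl O H).leftKanExtension M).map (back P.left) = M.map l ≫
        ((familyIncl O H).leftKanExtensionUnit M).app U := nat.symm
    rw [← Category.assoc]
    erw [h2]
    rw [hU.eq_of_tgt (M.map l) 0, zero_comp, zero_comp]
  change ((familyIncl O H).leftKanExtensionUnit M).app S ≫
      ((familyIncl O H).leftKanExtension M).map P.toHom ≫ _ =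
    ((familyIncl O H).leftKanExtensionUnit M).app S ≫
      ((familyIncl O H).leftKanExtension M).map P.toHom ≫ _
  rw [← Category.assoc, hz, zero_comp, ← Category.assoc, hz, zero_comp]

/-- The right Kan extension of an `[H]^O`-Mackey functor is an above-`[H]^O` Mackey functor. -/
theorem isAboveMackey_ran {M : FamilyLindner O H ⥤ ModuleCat.{v} k}
    (hM : IsClassMackey.{u, v} O H k M) :
    IsAboveMackey.{u, v} O H k ((familyIncl O H).ran.obj M) := by
  have := hM.1
  have hE := (familyIncl O H).isPointwiseRightKanExtensionRanCounit M
  refine ⟨ran_finiteProducts _ _ hE, fun L hL => ?_⟩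
  rw [IsZero.iff_id_eq_zero]
  refine (hE (orbitObj O L)).hom_ext' fun S f => ?_
  obtain ⟨P, rfl⟩ := Span.toHom_surjective f
  let U : FamilyLindner O H := ⟨⟨P.apex⟩, familyProp_of_map (S := S) P.right⟩
  have hU : IsZero (M.obj U) := isZero_of_orbits M hM.2 U (not_inseparable_apex hL P.left)
  let r : U ⟶ S := ObjectProperty.homMk (fwd P.right P.admissible)
  have nat := ((familyIncl O H).ranCounit.app M).naturality r
  have hz : ((familyIncl O H).ran.obj M).map P.toHom ≫
      ((familyIncl O H).ranCounit.app M).app S = 0 := by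
    rw [P.toHom_eq_back_fwd, Functor.map_comp, Category.assoc]
    have h2 : ((familyIncl O H).ran.obj M).map (fwd P.right P.admissible) ≫
        ((familyIncl O H).ranCounit.app M).app S =
        ((familyIncl O H).ranCounit.app M).app U ≫ M.map r := nat
    erw [h2]
    rw [hU.eq_of_src (M.map r) 0, comp_zero, comp_zero]
  change _ ≫ ((familyIncl O H).ran.obj M).map P.toHom ≫
      ((familyIncl O H).ranCounit.app M).app S = _ ≫ ((familyIncl O H).ran.obj M).map P.toHom ≫
      ((familyIncl O H).ranCounit.app M).app S
  rw [hz, comp_zero, comp_zero]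

variable (O H k)

/-- Induction: the left Kan extension along `A^O_(H) ⥤ A^O`, as a functor from `[H]^O`-Mackey
functors to above-`[H]^O` Mackey functors.  Since the functors involved preserve products, this is
the same as the coend `∫^{G/K} A^O(G/K, -) ⊗ M(G/K)`. -/
noncomputable def indFunctor : ClassMackey.{u, v} O H k ⥤ AboveMackey.{u, v} O H k :=
  (IsAboveMackey.{u, v} O H k).lift
    ((IsClassMackey.{u, v} O H k).ι ⋙ (familyIncl O H).lan) fun M => isAboveMackey_lan M.property

/-- Coinduction: the right Kan extension along `A^O_(H) ⥤ A^O`, as a functor from `[H]^O`-Mackey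
functors to above-`[H]^O` Mackey functors.  Since the functors involved preserve products, this is
the same as the end `∫_{G/K} hom(A^O(-, G/K), M(G/K))`. -/
noncomputable def coindFunctor : ClassMackey.{u, v} O H k ⥤ AboveMackey.{u, v} O H k :=
  (IsAboveMackey.{u, v} O H k).lift
    ((IsClassMackey.{u, v} O H k).ι ⋙ (familyIncl O H).ran) fun M => isAboveMackey_ran M.property

variable {O H}

/-- Induction is left adjoint to restriction. -/
noncomputable def indAdj (hH : O.rel H ⊤) :
    indFunctor.{u, v} O H k ⊣ resFunctor.{u, v} k hH :=
  ((familyIncl O H).lanAdjunction (ModuleCat.{v} k)).restrictFullyFaithful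
    (IsClassMackey.{u, v} O H k).fullyFaithfulι (IsAboveMackey.{u, v} O H k).fullyFaithfulι
    (Iso.refl _) (Iso.refl _)

/-- Coinduction is right adjoint to restriction. -/
noncomputable def coindAdj (hH : O.rel H ⊤) :
    resFunctor.{u, v} k hH ⊣ coindFunctor.{u, v} O H k :=
  ((familyIncl O H).ranAdjunction (ModuleCat.{v} k)).restrictFullyFaithful
    (IsAboveMackey.{u, v} O H k).fullyFaithfulι (IsClassMackey.{u, v} O H k).fullyFaithfulι
    (Iso.refl _) (Iso.refl _)

end Mackey

/-! ### The Weyl group action and the canonical maps -/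

section Trace

variable {k W V : Type*} [CommRing k] [Group W] [Finite W] [AddCommGroup V] [Module k V]

/-- The trace map `V_W → V^W` from coinvariants to invariants, sending the class of `m` to
`∑_{w ∈ W} w m`. -/
noncomputable def traceMap (ρ : Representation k W V) : ρ.Coinvariants →ₗ[k] ρ.invariants :=
  letI := Fintype.ofFinite W
  Representation.Coinvariants.lift ρ
    (LinearMap.codRestrict ρ.invariants ρ.norm fun m g => ρ.self_norm_apply g m)
    fun g => LinearMap.ext fun m => Subtype.ext (ρ.norm_self_apply g m)

end Trace

section Weyl

variable {G : Type u} [Group G]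

/-- The normalizer `N_L(J)`. -/
def normalizerIn (L J : Subgroup G) : Subgroup G := L ⊓ Subgroup.normalizer (J : Set G)

instance normal_subgroupOf_normalizerIn (L J : Subgroup G) :
    (J.subgroupOf (normalizerIn L J)).Normal :=
  Subgroup.normal_subgroupOf_of_le_normalizer inf_le_right

/-- The Weyl group `W_L(J) = N_L(J)/J`, for `J ≤ L`. -/
abbrev WeylGroup (L J : Subgroup G) : Type u := normalizerIn L J ⧸ J.subgroupOf (normalizerIn L J)

set_option linter.unusedSectionVars false

variable [Finite G] {O : TransferSystem G}

/-- The automorphism `gJ ↦ gnJ` of `G/J`, for `n` in the normalizer of `J`. -/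
def rightMul {L J : Subgroup G} (n : normalizerIn L J) : orbitSet J →[G] orbitSet J where
  toFun := Quotient.map' (fun g => g * n) fun a b h => by
    rw [QuotientGroup.leftRel_apply] at h ⊢
    have := (Subgroup.mem_normalizer_iff''.1 n.2.2 _).1 h
    simpa [mul_assoc] using this
  map_smul' := by
    rintro g ⟨x⟩
    exact congrArg (fun y : G => (y : G ⧸ J)) (mul_assoc g x n)

/-- The action of `W_L(J)` on `M(G/J)`, by restriction along the automorphisms `gJ ↦ gnJ`. -/
noncomputable def weylRep {k : Type} [CommRing k] (M : Lindner O ⥤ ModuleCat.{v} k)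
    (L J : Subgroup G) : Representation k (WeylGroup L J) (M.obj (orbitObj O J)) :=
  QuotientGroup.lift _
    { toFun := fun n => (M.map (back (S := orbitObj O J) (T := orbitObj O J) (rightMul n))).hom
      map_one' := by
        have : (rightMul (1 : normalizerIn L J)) = MulActionHom.id G := by
          ext ⟨x⟩
          exact congrArg (fun y : G => (y : G ⧸ J)) (mul_one x)
        rw [this, back_id, M.map_id]
        rfl
      map_mul' := fun a b => by
        have : rightMul (a * b) = (rightMul b).comp (rightMul a) := by
          ext ⟨x⟩
          exact congrArg (fun y : G => (y : G ⧸ J)) (mul_assoc x a b).symm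
        rw [this, ← back_comp_back (T := orbitObj O J), M.map_comp]
        rfl }
    fun n hn => by
      have : rightMul n = MulActionHom.id G := by
        ext ⟨x⟩
        exact QuotientGroup.mk_mul_of_mem x hn
      change (M.map (back (S := orbitObj O J) (T := orbitObj O J) (rightMul n))).hom = 1
      rw [this, back_id, M.map_id]
      rfl

/-- The projection `G/J → G/L` for `J ≤ L`. -/
def orbitMap {J L : Subgroup G} (h : J ≤ L) : orbitSet J →[G] orbitSet L where
  toFun := Subgroup.quotientMapOfLE h
  map_smul' := by
    rintro g ⟨x⟩
    rfl

theorem orbitMap_admissible {J L : Subgroup G} (h : O.rel J L) :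
    IsAdmissible O (orbitMap (O.le_of_rel h)) := by
  intro x
  obtain ⟨g, rfl⟩ := QuotientGroup.mk_surjective x
  have h1 : ∀ K : Subgroup G, stabilizer G (g : G ⧸ K) = conj g K := fun K => by
    rw [← stabilizer_orbitSet K g]
    change stabilizer G ((g : G ⧸ K)) = stabilizer G (((g * 1 : G)) : G ⧸ K)
    rw [mul_one]
  have := O.conj g h
  rw [← h1, ← h1] at this
  exact this

variable (O) in
/-- The transfer span `G/J = G/J → G/L` for `J → L` in `O`. -/
def transferHom {J L : Subgroup G} (h : O.rel J L) : orbitObj O J ⟶ orbitObj O L :=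
  fwd (orbitMap (O.le_of_rel h)) (orbitMap_admissible h)

variable (O) in
/-- The restriction span `G/L ← G/J = G/J` for `J ≤ L`. -/
def restrictHom {J L : Subgroup G} (h : J ≤ L) : orbitObj O L ⟶ orbitObj O J :=
  back (orbitMap h)

variable (O) in
/-- The set `T_{L ≥ [H]^O}` of the subgroups `L ∩ gHg⁻¹`, `g ∈ G`, that lie in `[H]^O`. -/
def maximalSet (H L : Subgroup G) : Set (Subgroup G) :=
  {J | (∃ g : G, J = L ⊓ conj g H) ∧ Inseparable O H J}

/-- `R` is a set of representatives for the `L`-conjugacy classes in `T`. -/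
def IsConjTransversal (L : Subgroup G) (T R : Set (Subgroup G)) : Prop :=
  R ⊆ T ∧ ∀ J ∈ T, ∃! J', J' ∈ R ∧ ∃ l ∈ L, conj l J = J'

variable {H L J : Subgroup G}

theorem rel_of_mem_maximalSet (hH : O.rel H ⊤) (hJ : J ∈ maximalSet O H L) : O.rel J L := by
  obtain ⟨⟨g, rfl⟩, -⟩ := hJ
  rw [inf_comm]
  exact O.restrict (rel_conj_top hH g) le_top

theorem isSubconj_of_mem_maximalSet (hJ : J ∈ maximalSet O H L) : IsSubconj J H := by
  obtain ⟨⟨g, rfl⟩, -⟩ := hJ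
  exact ⟨g, inf_le_right⟩

variable {k : Type} [CommRing k]

/-- The formal transfer `N(G/J) → (Ind N)(G/L)`: the unit of the adjunction at `G/J` followed by the
transfer from `G/J` to `G/L`. -/
noncomputable def formalTransfer (hH : O.rel H ⊤) (N : ClassMackey.{u, v} O H k)
    (hJ : J ∈ maximalSet O H L) :
    N.obj.obj (familyOrbit O H (isSubconj_of_mem_maximalSet hJ)) →ₗ[k]
      ((indFunctor.{u, v} O H k).obj N).obj.obj (orbitObj O L) :=
  (((indFunctor.{u, v} O H k).obj N).obj.map (transferHom O (rel_of_mem_maximalSet hH hJ))).hom ∘ₗ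
    (((indAdj.{u, v} k hH).unit.app N).hom.app
      (familyOrbit O H (isSubconj_of_mem_maximalSet hJ))).hom

/-- The formal restriction `(CoInd N)(G/L) → N(G/J)`: the restriction from `G/L` to `G/J` followed by
the counit of the adjunction at `G/J`. -/
noncomputable def formalRestriction (hH : O.rel H ⊤) (N : ClassMackey.{u, v} O H k)
    (hJ : J ∈ maximalSet O H L) :
    ((coindFunctor.{u, v} O H k).obj N).obj.obj (orbitObj O L) →ₗ[k]
      N.obj.obj (familyOrbit O H (isSubconj_of_mem_maximalSet hJ)) :=
  (((coindAdj.{u, v} k hH).counit.app N).hom.app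
      (familyOrbit O H (isSubconj_of_mem_maximalSet hJ))).hom ∘ₗ
    (((coindFunctor.{u, v} O H k).obj N).obj.map
      (restrictHom O (O.le_of_rel (rel_of_mem_maximalSet hH hJ)))).hom

/-- `Ind Res M`. -/
noncomputable abbrev indRes (hH : O.rel H ⊤) (M : AboveMackey.{u, v} O H k) :
    AboveMackey.{u, v} O H k :=
  (indFunctor.{u, v} O H k).obj ((resFunctor.{u, v} k hH).obj M)

/-- `CoInd Res M`. -/
noncomputable abbrev coindRes (hH : O.rel H ⊤) (M : AboveMackey.{u, v} O H k) :
    AboveMackey.{u, v} O H k :=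
  (coindFunctor.{u, v} O H k).obj ((resFunctor.{u, v} k hH).obj M)

/-- The comparison map `Ind Res M → M → CoInd Res M`: the counit of induction followed by the unit
of coinduction. -/
noncomputable def comparison (hH : O.rel H ⊤) (M : AboveMackey.{u, v} O H k) :
    indRes.{u, v} hH M ⟶ coindRes.{u, v} hH M :=
  (indAdj.{u, v} k hH).counit.app M ≫ (coindAdj.{u, v} k hH).unit.app M

end Weyl

end IncompleteMackey

open IncompleteMackey
open scoped DirectSum

/-!
The comparison map `κ : Ind Res M → M → CoInd Res M` is shown to be invertible without computing
the Kan extensions that define `Ind` and `CoInd`.  Fix `L` and representatives `R` of the maximal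
members of `[H]^O` below `L`.  Three facts suffice.

* The formal transfers from `G/J`, `J ∈ R`, jointly generate `(Ind N)(G/L)`.  The pointwise formula
  says that `(Ind N)(G/L)` is generated by the images of the `N(S)` under spans `S ← U → G/L`; since
  a product preserving functor sends a span to the sum of its restrictions to the orbits of `U`
  (`map_toHom_eq_sum_orbits`), only transfers along maps `G/K → G/L` with `K ∈ [H]^O` matter, and
  each of these factors through some `G/J` with `J ∈ R` (`exists_factor_orbitMap`).  This is
  `iSup_range_formalTransfer`.  Dually, the formal restrictions are jointly injective on
  `(CoInd N)(G/L)` (`eq_zero_of_formalRestriction`).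
* By the triangle identities, `κ` between a formal transfer from `G/J` and a formal restriction to
  `G/J'` is the transfer from `G/J` followed by the restriction to `G/J'` in `M`.  Decomposing
  `G/J ×_{G/L} G/J'` into orbits, an orbit with stabilizer above `[H]^O` forces `J = J'`, because
  comparable members of `[H]^O` have the same hull and a maximal member is recovered from its hull
  by `J = L ∩ H_O(J)`; for `J = J'` these orbits are the graphs of the elements of `W_L(J)`.  So the
  composite is zero for `J ≠ J'` (`map_transferHom_restrictHom_of_ne`) and the sum over the Weyl
  group for `J = J'` (`map_transferHom_restrictHom_self`).
* Over `ℚ` the trace map from coinvariants to invariants is bijective (`traceMap_bijective`).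

The composite `⨁ M(G/J)_W → (Ind Res M)(G/L) → (CoInd Res M)(G/L) → ∏ M(G/J)^W` is therefore
bijective, its first map is surjective and its last map is injective, so all three maps are
bijective (`exists_linearEquiv_of_trace`).  A transformation of product preserving functors that is
invertible at the orbits is invertible (`isIso_of_orbits`), whence `κ` is an isomorphism.
-/

namespace IncompleteMackey

/-! ### Trace maps over the rationals -/

section LinearAlgebra

theorem traceMap_mk {k W V : Type*} [CommRing k] [Group W] [Finite W] [Fintype W]
    [AddCommGroup V] [Module k V] (ρ : Representation k W V) (m : V) :
    (traceMap ρ (Representation.Coinvariants.mk ρ m) : V) = ∑ w, ρ w m := by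
  obtain rfl : ‹Fintype W› = Fintype.ofFinite W := Subsingleton.elim _ _
  exact LinearMap.sum_apply _ _ _

theorem traceMap_bijective {W V : Type*} [Group W] [Finite W] [AddCommGroup V] [Module ℚ V]
    (ρ : Representation ℚ W V) : Function.Bijective (traceMap ρ) := by
  have := Fintype.ofFinite W
  have hc : (Fintype.card W : ℚ) ≠ 0 := Nat.cast_ne_zero.2 Fintype.card_ne_zero
  constructor
  · rw [injective_iff_map_eq_zero]
    intro x hx
    induction x using Representation.Coinvariants.induction_on with
    | h m =>
      have h0 : ∑ w, ρ w m = 0 := by rw [← traceMap_mk, hx]; rfl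
      have h1 := congrArg (Representation.Coinvariants.mk ρ) h0
      simp only [map_sum, Representation.Coinvariants.mk_self_apply, Finset.sum_const,
        Finset.card_univ, map_zero, ← Nat.cast_smul_eq_nsmul ℚ] at h1
      exact (smul_eq_zero.1 h1).resolve_left hc
  · intro y
    refine ⟨Representation.Coinvariants.mk ρ ((Fintype.card W : ℚ)⁻¹ • (y : V)), Subtype.ext ?_⟩
    rw [traceMap_mk]
    have : ∀ w, ρ w (y : V) = y := y.2
    simp only [map_smul, this, Finset.sum_const, Finset.card_univ, ← Nat.cast_smul_eq_nsmul ℚ]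
    rw [smul_smul, mul_inv_cancel₀ hc, one_smul]

/-- If `κ : A → B` is sandwiched between invariant maps `T i : V i → A` that jointly generate `A`
and invariant maps `S i : B → V i` that are jointly injective, and if the resulting matrix is
diagonal with the trace maps as its entries, then these maps present `A` by coinvariants and `B` by
invariants.  Both halves, and the bijectivity of `κ`, follow from the bijectivity of the traces. -/
theorem exists_linearEquiv_of_trace {ι : Type*} [Finite ι] [DecidableEq ι] {W V : ι → Type*}
    [∀ i, Group (W i)] [∀ i, Finite (W i)] [∀ i, AddCommGroup (V i)] [∀ i, Module ℚ (V i)]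
    (ρ : ∀ i, Representation ℚ (W i) (V i)) {A B : Type*} [AddCommGroup A] [Module ℚ A]
    [AddCommGroup B] [Module ℚ B] (κ : A →ₗ[ℚ] B) (T : ∀ i, V i →ₗ[ℚ] A) (S : ∀ i, B →ₗ[ℚ] V i)
    (hT : ∀ i w, T i ∘ₗ ρ i w = T i) (hS : ∀ i w y, ρ i w (S i y) = S i y)
    (hTtop : ⨆ i, LinearMap.range (T i) = ⊤) (hSinj : ∀ y, (∀ i, S i y = 0) → y = 0)
    (hdiag : ∀ i m, S i (κ (T i m)) = traceMap (ρ i) (Representation.Coinvariants.mk (ρ i) m))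
    (hoff : ∀ i j, i ≠ j → ∀ m, S j (κ (T i m)) = 0) :
    Function.Bijective κ ∧
    ∃ (e : (⨁ i, (ρ i).Coinvariants) ≃ₗ[ℚ] A) (f : B ≃ₗ[ℚ] (∀ i, (ρ i).invariants)),
      (∀ i m, e (DirectSum.lof ℚ ι (fun i => (ρ i).Coinvariants) i
        (Representation.Coinvariants.mk (ρ i) m)) = T i m) ∧
      (∀ y i, (f y i : V i) = S i y) ∧
      ∀ x i, f (κ (e x)) i = traceMap (ρ i) (x i) := by
  let p : (⨁ i, (ρ i).Coinvariants) →ₗ[ℚ] A :=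
    DirectSum.toModule ℚ ι A fun i => Representation.Coinvariants.lift (ρ i) (T i) (hT i)
  let q : B →ₗ[ℚ] (∀ i, (ρ i).invariants) :=
    LinearMap.pi fun i => LinearMap.codRestrict (ρ i).invariants (S i) fun y w => hS i w y
  have hp : ∀ i m, p (DirectSum.lof ℚ ι (fun i => (ρ i).Coinvariants) i
      (Representation.Coinvariants.mk (ρ i) m)) = T i m := fun i m => by
    simp only [p, DirectSum.toModule_lof, Representation.Coinvariants.lift_mk]
  have hqp : ∀ x i, q (κ (p x)) i = traceMap (ρ i) (x i) := by
    intro x j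
    have : LinearMap.proj j ∘ₗ q ∘ₗ κ ∘ₗ p =
        traceMap (ρ j) ∘ₗ DirectSum.component ℚ ι (fun i => (ρ i).Coinvariants) j := by
      refine DirectSum.linearMap_ext _ fun i => Representation.Coinvariants.hom_ext ?_
      ext m
      change S j (κ (p (DirectSum.lof ℚ ι (fun i => (ρ i).Coinvariants) i _))) =
        (traceMap (ρ j) (DirectSum.lof ℚ ι (fun i => (ρ i).Coinvariants) i _ j) : V j)
      rw [hp]
      rcases eq_or_ne i j with rfl | hij
      · rw [hdiag]
        erw [DirectSum.lof_apply]
      · have h0 : DirectSum.lof ℚ ι (fun i => (ρ i).Coinvariants) i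
            (Representation.Coinvariants.mk (ρ i) m) j = 0 := DFinsupp.single_eq_of_ne hij.symm
        rw [hoff i j hij m, h0, map_zero]
        rfl
    exact LinearMap.congr_fun this x
  have hD : Function.Bijective (fun x => q (κ (p x))) := by
    constructor
    · intro x y hxy
      refine DFinsupp.ext fun i => (traceMap_bijective (ρ i)).1 ?_
      rw [← hqp, ← hqp]
      exact congrFun hxy i
    · intro y
      choose x hx using fun i => (traceMap_bijective (ρ i)).2 (y i)
      have := Fintype.ofFinite ι
      refine ⟨DFinsupp.equivFunOnFintype.symm x, funext fun i => ?_⟩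
      rw [← hx]
      exact hqp _ i
  have hpb : Function.Bijective p := by
    refine ⟨fun x y h => hD.1 (congrArg (fun a => q (κ a)) h), LinearMap.range_eq_top.1 ?_⟩
    rw [eq_top_iff, ← hTtop, iSup_le_iff]
    rintro i _ ⟨m, rfl⟩
    exact ⟨_, hp i m⟩
  have hqb : Function.Bijective q := by
    refine ⟨(injective_iff_map_eq_zero q).2 fun y hy => hSinj y fun i => ?_, fun y => ?_⟩
    · exact congrArg Subtype.val (congrFun hy i)
    · obtain ⟨x, hx⟩ := hD.2 y
      exact ⟨_, hx⟩
  refine ⟨?_, LinearEquiv.ofBijective p hpb, LinearEquiv.ofBijective q hqb, hp, fun _ _ => rfl, hqp⟩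
  have h1 : Function.Bijective (q ∘ κ) := (Function.Bijective.of_comp_iff (q ∘ κ) hpb).1 hD
  exact (Function.Bijective.of_comp_iff' hqb κ).1 h1

end LinearAlgebra

/-! ### Decomposing a span along the orbits of its apex -/

section Decomposition

variable {G : Type u} [Group G] {O : TransferSystem G}

theorem fwd_comp_fwd {S T R : Lindner O} (f : S.set →[G] T.set) (hf : IsAdmissible O f)
    (h : T.set →[G] R.set) (hh : IsAdmissible O h) (hhf : IsAdmissible O (h.comp f)) :
    fwd f hf ≫ fwd h hh = (fwd (h.comp f) hhf : S ⟶ R) := by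
  refine Span.toHom_eq ⟨⟨fun p => p.1.1, fun _ _ => rfl⟩,
    ⟨?_, fun x => ⟨⟨(x, f x), rfl⟩, rfl⟩⟩, fun _ => rfl, fun p => congrArg h p.2⟩
  rintro ⟨⟨a, b⟩, k⟩ ⟨⟨a', b'⟩, k'⟩ (e : a = a')
  subst e
  exact Subtype.ext (Prod.ext rfl (Eq.trans (Eq.symm k) k'))

/-- If `f` is admissible and factors as `f = h ∘ f₁`, then `f₁` is admissible: restrict the
transfers `Stab(x) → Stab(f x)` to `Stab(f₁ x)`. -/
theorem IsAdmissible.of_comp {S T R : FinGSet G} {f : S →[G] R} (hf : IsAdmissible O f)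
    (f₁ : S →[G] T) (h : T →[G] R) (e : ∀ x, h (f₁ x) = f x) : IsAdmissible O f₁ := by
  intro x
  have h1 : stabilizer G x ≤ stabilizer G (f₁ x) := fun g hg => by
    rw [mem_stabilizer_iff] at *
    rw [← map_smul, hg]
  have h2 : stabilizer G (f₁ x) ≤ stabilizer G (f x) := fun g hg => by
    rw [mem_stabilizer_iff] at *
    rw [← e, ← map_smul, hg]
  simpa [inf_eq_left.2 h1] using O.restrict (hf x) h2

/-- The span obtained by precomposing both legs with an injection into the apex. -/
def Span.comap {S T : FinGSet G} (P : Span O S T) {V : FinGSet G} (j : V →[G] P.apex)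
    (hj : Function.Injective j) : Span O S T where
  apex := V
  left := P.left.comp j
  right := P.right.comp j
  admissible x := O.trans (isAdmissible_of_injective j hj x) (P.admissible (j x))

theorem Span.comap_iso {S T : FinGSet G} (P : Span O S T) {V : FinGSet G} (j : V →[G] P.apex)
    (hj : Function.Bijective j) : (P.comap j hj.1).Iso P :=
  ⟨j, hj, fun _ => rfl, fun _ => rfl⟩

/-- The invariant subset of a finite `G`-set on which an invariant function takes values in `s`. -/
def FinGSet.fiber (U : FinGSet G) {I : Type*} (c : U → I) (hc : ∀ (g : G) x, c (g • x) = c x)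
    (s : Set I) : FinGSet G where
  carrier := ({ carrier := {x | c x ∈ s}
                smul_mem' := fun g x hx => by
                  rw [Set.mem_ofPred_eq, hc]
                  exact hx } : SubMulAction G U)

/-- The inclusion of a fibre. -/
def FinGSet.fiberIncl (U : FinGSet G) {I : Type*} (c : U → I)
    (hc : ∀ (g : G) x, c (g • x) = c x) (s : Set I) : U.fiber c hc s →[G] U :=
  ⟨Subtype.val, fun _ _ => rfl⟩

/-- The inclusion of a fibre in a larger one. -/
def FinGSet.fiberMono (U : FinGSet G) {I : Type*} (c : U → I)
    (hc : ∀ (g : G) x, c (g • x) = c x) {s t : Set I} (h : s ⊆ t) :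
    U.fiber c hc s →[G] U.fiber c hc t :=
  ⟨fun x => ⟨x.1, h x.2⟩, fun _ _ => rfl⟩

variable {A : Type*} [Category* A] [Preadditive A] [HasZeroObject A]

/-- In the image of a product preserving functor, the identity of a disjoint union is the sum of
the two projectors, as in a biproduct. -/
theorem map_sum_total (F : Lindner O ⥤ A) [PreservesFiniteProducts F] (X Y : Lindner O) :
    F.map (sumFst X Y ≫ sumInl X Y) + F.map (sumSnd X Y ≫ sumInr X Y) = 𝟙 _ := by
  have := preservesZero_of_finiteProducts F
  have h := (isLimitMapConeBinaryFanEquiv F _ _)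
    (isLimitOfPreserves F (sumBicone_isBilimit X Y).some.isLimit)
  apply BinaryFan.IsLimit.hom_ext h
  · change _ ≫ F.map (sumFst X Y) = _ ≫ F.map (sumFst X Y)
    rw [Preadditive.add_comp, ← F.map_comp, ← F.map_comp, Category.assoc, Category.assoc,
      sumInl_sumFst, sumInr_sumFst, Category.comp_id, comp_zero, F.map_zero, add_zero,
      Category.id_comp]
  · change _ ≫ F.map (sumSnd X Y) = _ ≫ F.map (sumSnd X Y)
    rw [Preadditive.add_comp, ← F.map_comp, ← F.map_comp, Category.assoc, Category.assoc,
      sumInl_sumSnd, sumInr_sumSnd, Category.comp_id, comp_zero, F.map_zero, zero_add,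
      Category.id_comp]

/-- A product preserving functor is additive along a decomposition of the apex of a span. -/
theorem map_toHom_add (F : Lindner O ⥤ A) [PreservesFiniteProducts F] {S T : Lindner O}
    (P : Span O S.set T.set) {V W : FinGSet G} (a : V →[G] P.apex) (b : W →[G] P.apex)
    (h : Function.Bijective (Sum.elim a b)) :
    F.map P.toHom =
      F.map (P.comap a (h.1.comp Sum.inl_injective)).toHom +
        F.map (P.comap b (h.1.comp Sum.inr_injective)).toHom := by
  let e : V.sum W →[G] P.apex := ⟨Sum.elim a b, by
    rintro g (x | x)
    exacts [map_smul a g x, map_smul b g x]⟩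
  let X : Lindner O := ⟨V⟩
  let Y : Lindner O := ⟨W⟩
  let l : (X.sum Y).set →[G] S.set := P.left.comp e
  let r : (X.sum Y).set →[G] T.set := P.right.comp e
  have hr : IsAdmissible O r := (P.comap e h.1).admissible
  have hQ : P.toHom = back l ≫ fwd r hr := by
    rw [← Span.toHom_eq (P.comap_iso e h)]
    exact Span.toHom_eq_back_fwd (P.comap e h.1)
  have key : F.map P.toHom = F.map (back l) ≫
      (F.map (sumFst X Y ≫ sumInl X Y) + F.map (sumSnd X Y ≫ sumInr X Y)) ≫
      F.map (fwd r hr) := by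
    rw [map_sum_total, Category.id_comp, ← F.map_comp, hQ]
  rw [key, Preadditive.add_comp, Preadditive.comp_add, ← F.map_comp, ← F.map_comp, ← F.map_comp,
    ← F.map_comp]
  congr 2
  · have h1 : back l ≫ sumFst X Y = back (P.left.comp a) := back_comp_back l (inlMap V W)
    have h2 : sumInl X Y ≫ fwd r hr = fwd (P.right.comp a)
        (P.comap a (h.1.comp Sum.inl_injective)).admissible := fwd_comp_fwd (inlMap V W) _ r hr _
    rw [Span.toHom_eq_back_fwd, Category.assoc, ← Category.assoc, h1, h2]
    rfl
  · have h1 : back l ≫ sumSnd X Y = back (P.left.comp b) := back_comp_back l (inrMap V W)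
    have h2 : sumInr X Y ≫ fwd r hr = fwd (P.right.comp b)
        (P.comap b (h.1.comp Sum.inr_injective)).admissible := fwd_comp_fwd (inrMap V W) _ r hr _
    rw [Span.toHom_eq_back_fwd, Category.assoc, ← Category.assoc, h1, h2]
    rfl

/-- Additivity along the fibres of an invariant function on the apex, by induction on the set of
values. -/
theorem map_toHom_eq_sum_fiber (F : Lindner O ⥤ A) [PreservesFiniteProducts F] {S T : Lindner O}
    (P : Span O S.set T.set) {I : Type*} (c : P.apex → I) (hc : ∀ (g : G) x, c (g • x) = c x)
    (s : Finset I) :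
    F.map (P.comap (P.apex.fiberIncl c hc (s : Set I)) Subtype.val_injective).toHom =
      ∑ i ∈ s, F.map (P.comap (P.apex.fiberIncl c hc {i}) Subtype.val_injective).toHom := by
  classical
  have := preservesZero_of_finiteProducts F
  induction s using Finset.induction_on with
  | empty =>
    rw [Span.toHom_eq_zero _ ⟨fun x => ?_⟩, F.map_zero, Finset.sum_empty]
    have h : c x.1 ∈ ((∅ : Finset I) : Set I) := x.2
    simp at h
  | insert i s hi ih =>
    rw [Finset.sum_insert hi, ← ih]
    have h1 : ({i} : Set I) ⊆ ((insert i s : Finset I) : Set I) := by simp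
    have h2 : (s : Set I) ⊆ ((insert i s : Finset I) : Set I) := by simp
    refine map_toHom_add F (P.comap (P.apex.fiberIncl c hc _) Subtype.val_injective)
      (P.apex.fiberMono c hc h1) (P.apex.fiberMono c hc h2) ⟨?_, ?_⟩
    · rintro (⟨x, hx⟩ | ⟨x, hx⟩) (⟨y, hy⟩ | ⟨y, hy⟩) hxy
      · obtain rfl : x = y := congrArg Subtype.val hxy
        rfl
      · obtain rfl : x = y := congrArg Subtype.val hxy
        obtain rfl : c x = i := hx
        exact absurd hy hi
      · obtain rfl : x = y := congrArg Subtype.val hxy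
        obtain rfl : c x = i := hy
        exact absurd hx hi
      · obtain rfl : x = y := congrArg Subtype.val hxy
        rfl
    · rintro ⟨x, hx⟩
      rcases Finset.mem_insert.1 hx with h | h
      · exact ⟨Sum.inl ⟨x, h⟩, rfl⟩
      · exact ⟨Sum.inr ⟨x, h⟩, rfl⟩

variable [Finite G]

/-- The `G`-map `G/Stab(x) → U`, `g ↦ g x`. -/
def orbitIncl {U : FinGSet G} (x : U) : orbitSet (stabilizer G x) →[G] U :=
  ⟨ofQuotientStabilizer G x, ofQuotientStabilizer_smul G x⟩

theorem orbitIncl_injective {U : FinGSet G} (x : U) : Function.Injective (orbitIncl x) :=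
  injective_ofQuotientStabilizer G x

/-- The restriction of a span to the orbit of a point `x` of its apex, with apex `G/Stab(x)`. -/
def Span.orbitSpan {S T : FinGSet G} (P : Span O S T) (x : P.apex) : Span O S T :=
  P.comap (orbitIncl x) (orbitIncl_injective x)

theorem map_orbitSpan_eq_fiber {C : Type*} [Category* C] (F : Lindner O ⥤ C)
    {S T : Lindner O} (P : Span O S.set T.set)
    (x : P.apex) :
    F.map (P.orbitSpan x).toHom =
      F.map (P.comap (P.apex.fiberIncl (Quotient.mk (orbitRel G P.apex))
        (fun g _ => Quotient.sound ⟨g, rfl⟩) {Quotient.mk _ x}) Subtype.val_injective).toHom := by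
  congr 1
  refine Span.toHom_eq ⟨⟨fun y => ⟨orbitIncl x y, ?_⟩, fun g y => Subtype.ext
    (map_smul (orbitIncl x) g y)⟩, ⟨fun y z h => orbitIncl_injective x (congrArg Subtype.val h),
    ?_⟩, fun _ => rfl, fun _ => rfl⟩
  · obtain ⟨g, rfl⟩ := QuotientGroup.mk_surjective y
    exact Quotient.sound ⟨g, rfl⟩
  · rintro ⟨y, hy⟩
    obtain ⟨g, rfl⟩ := Quotient.exact hy
    exact ⟨(g : G ⧸ stabilizer G x), rfl⟩

theorem map_orbitSpan_congr {C : Type*} [Category* C] (F : Lindner O ⥤ C) {S T : Lindner O}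
    (P : Span O S.set T.set) {x y : P.apex} (h : orbitRel G P.apex x y) :
    F.map (P.orbitSpan x).toHom = F.map (P.orbitSpan y).toHom := by
  have : (Quotient.mk (orbitRel G P.apex) x) = Quotient.mk _ y := Quotient.sound h
  rw [map_orbitSpan_eq_fiber, map_orbitSpan_eq_fiber, this]

/-- A product preserving functor takes a span to the sum of its restrictions to the orbits of the
apex. -/
theorem map_toHom_eq_sum_orbits (F : Lindner O ⥤ A) [PreservesFiniteProducts F] {S T : Lindner O}
    (P : Span O S.set T.set) [Fintype (Quotient (orbitRel G P.apex))] :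
    F.map P.toHom = ∑ ω : Quotient (orbitRel G P.apex), F.map (P.orbitSpan ω.out).toHom := by
  let c : P.apex → Quotient (orbitRel G P.apex) := Quotient.mk _
  have hc : ∀ (g : G) x, c (g • x) = c x := fun g x => Quotient.sound ⟨g, rfl⟩
  have h := map_toHom_eq_sum_fiber F P c hc Finset.univ
  have hb : Function.Bijective (P.apex.fiberIncl c hc
      ((Finset.univ : Finset (Quotient (orbitRel G P.apex))) : Set _)) :=
    ⟨Subtype.val_injective, fun x => ⟨⟨x, Finset.mem_coe.2 (Finset.mem_univ _)⟩, rfl⟩⟩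
  rw [Span.toHom_eq (P.comap_iso _ hb)] at h
  rw [h]
  refine Finset.sum_congr rfl fun ω _ => ?_
  rw [map_orbitSpan_eq_fiber, Quotient.out_eq ω]

theorem map_orbitSpan {C : Type*} [Category* C] (F : Lindner O ⥤ C)
    {S T : Lindner O} (P : Span O S.set T.set)
    (x : P.apex) :
    F.map (P.orbitSpan x).toHom =
      F.map (back (T := orbitObj O (stabilizer G x)) (P.left.comp (orbitIncl x))) ≫
        F.map (fwd (S := orbitObj O (stabilizer G x)) (P.right.comp (orbitIncl x))
          (P.orbitSpan x).admissible) := by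
  rw [← F.map_comp]
  exact congrArg F.map (Span.toHom_eq_back_fwd _)

/-- A transformation of product preserving functors is invertible if it is so on the orbits. -/
theorem isIso_of_orbits {F F' : Lindner O ⥤ A} [PreservesFiniteProducts F]
    [PreservesFiniteProducts F'] (α : F ⟶ F')
    (hα : ∀ K : Subgroup G, IsIso (α.app (orbitObj O K))) : IsIso α := by
  have : ∀ X, IsIso (α.app X) := by
    intro X
    let P : Span O X.set X.set := Span.id X.set
    have := Fintype.ofFinite (Quotient (orbitRel G P.apex))
    have hid : ∀ (E : Lindner O ⥤ A) [PreservesFiniteProducts E],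
        𝟙 (E.obj X) = ∑ ω : Quotient (orbitRel G P.apex), E.map (P.orbitSpan ω.out).toHom := by
      intro E _
      rw [← map_toHom_eq_sum_orbits, ← E.map_id]
      rfl
    let b := fun ω : Quotient (orbitRel G P.apex) =>
      (back (T := orbitObj O (stabilizer G ω.out)) (P.left.comp (orbitIncl ω.out)) : X ⟶ _)
    let f := fun ω : Quotient (orbitRel G P.apex) =>
      (fwd (S := orbitObj O (stabilizer G ω.out)) (P.right.comp (orbitIncl ω.out))
          (P.orbitSpan ω.out).admissible : _ ⟶ X)
    have hbf : ∀ (E : Lindner O ⥤ A) ω, E.map (P.orbitSpan ω.out).toHom =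
      E.map (b ω) ≫ E.map (f ω) := fun E ω => map_orbitSpan E P _
    -- The inverse is assembled from the inverses at the orbits of `X`.
    refine ⟨∑ ω, F'.map (b ω) ≫ inv (α.app (orbitObj O (stabilizer G ω.out))) ≫ F.map (f ω),
      ?_, ?_⟩
    · rw [Preadditive.comp_sum, hid]
      refine Finset.sum_congr rfl fun ω _ => ?_
      rw [hbf, ← Category.assoc, ← α.naturality, Category.assoc, IsIso.hom_inv_id_assoc]
    · rw [Preadditive.sum_comp, hid]
      refine Finset.sum_congr rfl fun ω _ => ?_
      rw [hbf, Category.assoc, Category.assoc, α.naturality, IsIso.inv_hom_id_assoc]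
  exact NatIso.isIso_of_isIso_app α

end Decomposition

/-! ### Hulls of inseparable subgroups and maps between orbits -/

section Subgroups

variable {G : Type u} [Group G]

theorem conj_inf (g : G) (H K : Subgroup G) : conj g (H ⊓ K) = conj g H ⊓ conj g K := by
  ext x
  simp only [mem_conj, Subgroup.mem_inf]

theorem conj_eq_self {g : G} {H : Subgroup G} (hg : g ∈ H) : conj g H = H := by
  ext x
  rw [mem_conj, H.mul_mem_cancel_right hg, H.mul_mem_cancel_left (H.inv_mem hg)]

theorem conj_inv_conj (g : G) (H : Subgroup G) : conj g⁻¹ (conj g H) = H := by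
  rw [← conj_mul, inv_mul_cancel, conj_one]

theorem mem_normalizer_of_conj_eq {g : G} {H : Subgroup G} (h : conj g H = H) :
    g ∈ Subgroup.normalizer (H : Set G) := by
  rw [Subgroup.mem_normalizer_iff'']
  intro x
  rw [← mem_conj (H := H), h]

variable {O : TransferSystem G} {H L J K : Subgroup G}

theorem Inseparable.conj (h : Inseparable O H J) (g : G) :
    Inseparable O H (IncompleteMackey.conj g J) := by
  obtain ⟨a, ha⟩ := h
  exact ⟨g * a, by rw [conj_mul, ha, hull_conj]⟩

/-- The hulls of the members of `[H]^O` all have the same order, so comparable members have equal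
hulls. -/
theorem hull_eq_hull_of_isAbove [Finite G] (hK : IsAbove O H K) (hKJ : K ≤ J)
    (hJ : Inseparable O H J) : hull O K = hull O J := by
  obtain ⟨K₀, ⟨a, ha⟩, h⟩ := hK
  obtain ⟨b, hb⟩ := hJ
  have hc : ∀ x : G, Nat.card (conj x (hull O H)) = Nat.card (hull O H) := fun x =>
    Nat.card_congr (Subgroup.equivSMul (MulAut.conj x) (hull O H)).symm.toEquiv
  have h1 : hull O K₀ ≤ hull O K := hull_mono h
  have h2 : hull O K ≤ hull O J := hull_mono hKJ
  have h3 : hull O K₀ = hull O J :=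
    Subgroup.eq_of_le_of_card_ge (h1.trans h2) (by rw [← ha, ← hb, hc, hc])
  exact le_antisymm h2 (h3 ▸ h1)

/-- A subgroup `L ∩ gHg⁻¹` is the intersection of `L` with its own hull. -/
theorem eq_inf_hull_of_mem_maximalSet (hH : O.rel H ⊤) (hJ : J ∈ maximalSet O H L) :
    J = L ⊓ hull O J := by
  obtain ⟨⟨g, hg⟩, -⟩ := hJ
  have hle : hull O J ≤ conj g H :=
    hull_le (hg.le.trans inf_le_right) (rel_conj_top hH g)
  exact le_antisymm (le_inf (hg.le.trans inf_le_left) (le_hull J))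
    ((inf_le_inf_left L hle).trans hg.ge)

theorem le_of_mem_maximalSet (hJ : J ∈ maximalSet O H L) : J ≤ L := by
  obtain ⟨⟨g, rfl⟩, -⟩ := hJ
  exact inf_le_left

/-- `L`-conjugacy classes in a set of subgroups admit representatives. -/
theorem exists_isConjTransversal (L : Subgroup G) (T : Set (Subgroup G)) :
    ∃ R, IsConjTransversal L T R := by
  let s : Setoid T :=
    { r := fun J K => ∃ l ∈ L, conj l J.1 = K.1
      iseqv :=
        { refl := fun J => ⟨1, L.one_mem, conj_one _⟩
          symm := by
            rintro J K ⟨l, hl, h⟩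
            exact ⟨l⁻¹, L.inv_mem hl, by rw [← h, conj_inv_conj]⟩
          trans := by
            rintro J K I ⟨l, hl, h⟩ ⟨m, hm, h'⟩
            exact ⟨m * l, L.mul_mem hm hl, by rw [conj_mul, h, h']⟩ } }
  refine ⟨Set.range fun q : Quotient s => (q.out : Subgroup G), ?_, fun J hJ => ?_⟩
  · rintro _ ⟨q, rfl⟩
    exact q.out.2
  · let q : Quotient s := Quotient.mk s ⟨J, hJ⟩
    refine ⟨q.out, ⟨⟨q, rfl⟩, s.symm (Quotient.mk_out (s := s) ⟨J, hJ⟩)⟩, ?_⟩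
    rintro _ ⟨⟨q', rfl⟩, h⟩
    have : q = q' := by
      rw [← q'.out_eq]
      exact Quotient.sound h
    rw [this]

theorem IsConjTransversal.mem {T R : Set (Subgroup G)} (hR : IsConjTransversal L T R)
    (hJ : J ∈ R) : J ∈ T :=
  hR.1 hJ

theorem IsConjTransversal.eq_of_conj_eq {T R : Set (Subgroup G)} (hR : IsConjTransversal L T R)
    (hJ : J ∈ R) (hK : K ∈ R) {l : G} (hl : l ∈ L) (h : conj l J = K) : J = K :=
  (hR.2 J (hR.1 hJ)).unique ⟨hJ, 1, L.one_mem, conj_one J⟩ ⟨hK, l, hl, h⟩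

theorem stabilizer_le_of_map {S T : FinGSet G} (f : S →[G] T) (x : S) :
    stabilizer G x ≤ stabilizer G (f x) := fun g hg => by
  rw [mem_stabilizer_iff] at *
  rw [← map_smul, hg]

variable [Finite G]

/-- The `G`-map `G/K → G/J`, `gK ↦ gbJ`, for `K ≤ bJb⁻¹`. -/
def orbitHom (b : G) (h : K ≤ conj b J) : orbitSet K →[G] orbitSet J where
  toFun := Quotient.map' (fun g => g * b) fun x y hxy => by
    rw [QuotientGroup.leftRel_apply] at hxy ⊢
    have := mem_conj.1 (h hxy)
    simpa [mul_assoc] using this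
  map_smul' := by
    rintro g ⟨x⟩
    exact congrArg (fun y : G => (y : G ⧸ J)) (mul_assoc g x b)

theorem stabilizer_mk (K : Subgroup G) (g : G) :
    stabilizer G (QuotientGroup.mk g : orbitSet K) = conj g K := by
  rw [← stabilizer_orbitSet K g]
  change stabilizer G ((g : G ⧸ K)) = stabilizer G (((g * 1 : G)) : G ⧸ K)
  rw [mul_one]

/-- On an orbit with stabilizer in `[H]^O`, every `G`-map to `G/L` factors through the projection
`G/J → G/L` of a representative `J` of the maximal members of `[H]^O` below `L`. -/
theorem exists_factor_orbitMap (hH : O.rel H ⊤) {R : Set (Subgroup G)}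
    (hR : IsConjTransversal L (maximalSet O H L) R) {U : FinGSet G} (h : U →[G] orbitSet L) (x : U)
    (hx : Inseparable O H (stabilizer G x)) :
    ∃ (J : Subgroup G) (hJ : J ∈ R) (h₁ : orbitSet (stabilizer G x) →[G] orbitSet J),
      ∀ y, orbitMap (le_of_mem_maximalSet (hR.mem hJ)) (h₁ y) = h (orbitIncl x y) := by
  obtain ⟨a, ha⟩ := QuotientGroup.mk_surjective (h x)
  obtain ⟨g, hg⟩ := hx
  rw [hull_eq hH] at hg
  have hle : conj a⁻¹ (stabilizer G x) ≤ L := by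
    rw [conj_le_iff, inv_inv, ← stabilizer_mk L a, ha]
    exact stabilizer_le_of_map h x
  have hle' : conj a⁻¹ (stabilizer G x) ≤ conj (a⁻¹ * g) H := by
    rw [conj_mul, hg]
    exact conj_mono (le_hull _)
  -- The stabilizer of `x`, moved below `L`, lies in the maximal member `L ∩ a⁻¹gHg⁻¹a`, because
  -- its hull is `a⁻¹gHg⁻¹a`.
  have hT : L ⊓ conj (a⁻¹ * g) H ∈ maximalSet O H L := by
    refine ⟨⟨_, rfl⟩, inseparable_of_isAbove hH ⟨_, inf_le_right⟩
      ⟨_, ⟨a⁻¹ * g, ?_⟩, le_inf hle hle'⟩⟩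
    rw [hull_eq hH, hull_conj, ← hg, conj_mul]
  obtain ⟨J, ⟨hJ, l, hl, hlJ⟩, -⟩ := hR.2 _ hT
  have hK : stabilizer G x ≤ conj (a * l⁻¹) J := by
    rw [← hlJ, conj_mul, conj_inv_conj]
    have := le_inf hle hle'
    rwa [conj_le_iff, inv_inv] at this
  refine ⟨J, hJ, orbitHom (a * l⁻¹) hK, fun y => ?_⟩
  obtain ⟨c, rfl⟩ := QuotientGroup.mk_surjective y
  have h1 : h (orbitIncl x (c : G ⧸ stabilizer G x)) = c • h x := map_smul h c x
  rw [h1, ← ha]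
  refine QuotientGroup.eq.2 ?_
  have h2 : (c * (a * l⁻¹))⁻¹ * (c * a) = l := by group
  change (c * (a * l⁻¹))⁻¹ * (c * a) ∈ L
  rwa [h2]

/-- If conjugates of two maximal members `J`, `J'` of `[H]^O` below `L` have a common subgroup that
is above `[H]^O`, then `J` and `J'` are conjugate: the conjugates have the same hull, which together
with `L` determines them. -/
theorem conj_eq_conj_of_isAbove {J' : Subgroup G} (hH : O.rel H ⊤) (hJ : J ∈ maximalSet O H L)
    (hJ' : J' ∈ maximalSet O H L) (hK : IsAbove O H K) {a b : G} (hab : b⁻¹ * a ∈ L)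
    (ha : K ≤ conj a J) (hb : K ≤ conj b J') : conj (b⁻¹ * a) J = J' := by
  have h1 : conj a (hull O J) = conj b (hull O J') := by
    rw [← hull_conj, ← hull_conj, ← hull_eq_hull_of_isAbove hK ha (hJ.2.conj a),
      ← hull_eq_hull_of_isAbove hK hb (hJ'.2.conj b)]
  rw [eq_inf_hull_of_mem_maximalSet hH hJ, conj_inf, conj_eq_self hab, conj_mul, h1,
    conj_inv_conj, ← eq_inf_hull_of_mem_maximalSet hH hJ']

end Subgroups

/-! ### The double coset formula -/

section DoubleCoset

variable {G : Type u} [Group G] [Finite G] {O : TransferSystem G} {H L J J' : Subgroup G}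

theorem orbitMap_rightMul (h : J ≤ L) (n : normalizerIn L J) (x : orbitSet J) :
    orbitMap h (rightMul n x) = orbitMap h x := by
  obtain ⟨g, rfl⟩ := QuotientGroup.mk_surjective x
  refine QuotientGroup.eq.2 ?_
  have h1 : (g * (n : G))⁻¹ * g = (n : G)⁻¹ := by group
  change (g * (n : G))⁻¹ * g ∈ L
  rw [h1]
  exact L.inv_mem n.2.1

theorem rightMul_inv_rightMul (n : normalizerIn L J) (x : orbitSet J) :
    rightMul n⁻¹ (rightMul n x) = x := by
  obtain ⟨g, rfl⟩ := QuotientGroup.mk_surjective x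
  exact congrArg (fun y : G => (y : G ⧸ J)) (mul_inv_cancel_right g (n : G))

theorem rightMul_bijective (n : normalizerIn L J) :
    Function.Bijective (rightMul n : orbitSet J →[G] orbitSet J) :=
  Function.bijective_iff_has_inverse.2 ⟨rightMul n⁻¹, rightMul_inv_rightMul n, fun x => by
    simpa using rightMul_inv_rightMul n⁻¹ x⟩

/-- The restriction along an automorphism of `G/J` over `G/L` is also the transfer along its
inverse, so it is absorbed by the transfer to `G/L`. -/
theorem back_rightMul_transferHom (h : O.rel J L) (n : normalizerIn L J) :
    (back (rightMul n) : orbitObj O J ⟶ orbitObj O J) ≫ transferHom O h = transferHom O h := by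
  refine Span.toHom_eq ⟨⟨fun p => rightMul n p.1.1, fun g p => map_smul (rightMul n) g p.1.1⟩,
    ⟨?_, fun x => ?_⟩, fun _ => rfl, fun p => ?_⟩
  · rintro ⟨⟨a, b⟩, k⟩ ⟨⟨a', b'⟩, k'⟩ e
    obtain rfl : a = a' := (rightMul_bijective n).1 e
    exact Subtype.ext (Prod.ext rfl (Eq.trans (Eq.symm k) k'))
  · obtain ⟨y, rfl⟩ := (rightMul_bijective n).2 x
    exact ⟨⟨(y, y), rfl⟩, rfl⟩
  · exact (orbitMap_rightMul _ n _).trans (congrArg (orbitMap (O.le_of_rel h)) p.2)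

theorem restrictHom_back_rightMul (h : J ≤ L) (n : normalizerIn L J) :
    restrictHom O h ≫ (back (rightMul n) : orbitObj O J ⟶ orbitObj O J) = restrictHom O h := by
  refine (back_comp_back (S := orbitObj O L) (T := orbitObj O J) (R := orbitObj O J) _ _).trans ?_
  refine congrArg (back (S := orbitObj O L) (T := orbitObj O J)) ?_
  ext x
  exact orbitMap_rightMul h n x

/-- The span `G/J ← G/J ×_{G/L} G/J' → G/J'` that computes a transfer to `G/L` followed by a
restriction. -/
def mackeySpan (h : O.rel J L) (h' : J' ≤ L) : Span O (orbitSet J) (orbitSet J') :=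
  (fwdSpan (orbitMap (O.le_of_rel h)) (orbitMap_admissible h)).comp (backSpan O (orbitMap h'))

theorem transferHom_restrictHom (h : O.rel J L) (h' : J' ≤ L) :
    transferHom O h ≫ restrictHom O h' =
      (mackeySpan h h').toHom (S := orbitObj O J) (T := orbitObj O J') := rfl

/-- A point of `G/J ×_{G/L} G/J'` with stabilizer above `[H]^O` exhibits `J` and `J'` as
`L`-conjugate. -/
theorem conj_eq_of_isAbove_mackeySpan (hH : O.rel H ⊤) (hJ : J ∈ maximalSet O H L)
    (hJ' : J' ∈ maximalSet O H L)
    (p : (mackeySpan (rel_of_mem_maximalSet hH hJ) (le_of_mem_maximalSet hJ')).apex)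
    (hp : IsAbove O H (stabilizer G p)) :
    ∃ a b : G, b⁻¹ * a ∈ L ∧ conj (b⁻¹ * a) J = J' ∧
      p.1 = ((QuotientGroup.mk a : G ⧸ J), (QuotientGroup.mk b : G ⧸ J')) := by
  let P := mackeySpan (rel_of_mem_maximalSet hH hJ) (le_of_mem_maximalSet hJ')
  obtain ⟨a, ha⟩ := QuotientGroup.mk_surjective (P.left p)
  obtain ⟨b, hb⟩ := QuotientGroup.mk_surjective (P.right p)
  have hab : (QuotientGroup.mk a : G ⧸ L) = QuotientGroup.mk b := by
    have h := p.2
    have e1 : p.1.1 = (QuotientGroup.mk a : G ⧸ J) := ha.symm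
    have e2 : p.1.2 = (QuotientGroup.mk b : G ⧸ J') := hb.symm
    rw [e1, e2] at h
    exact h
  have hL : b⁻¹ * a ∈ L := QuotientGroup.eq.1 hab.symm
  have h1 := (stabilizer_le_of_map P.left p).trans
    ((congrArg (stabilizer G) ha.symm).trans (stabilizer_mk J a)).le
  have h2 := (stabilizer_le_of_map P.right p).trans
    ((congrArg (stabilizer G) hb.symm).trans (stabilizer_mk J' b)).le
  exact ⟨a, b, hL, conj_eq_conj_of_isAbove hH hJ hJ' hp hL h1 h2, Prod.ext ha.symm hb.symm⟩

variable {k : Type} [CommRing k]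

theorem map_orbitSpan_eq_zero {M : Lindner O ⥤ ModuleCat.{v} k} (hM : IsAboveMackey.{u, v} O H k M)
    {S T : Lindner O} (P : Span O S.set T.set) (x : P.apex)
    (hx : ¬ IsAbove O H (stabilizer G x)) : M.map (P.orbitSpan x).toHom = 0 := by
  rw [map_orbitSpan, (hM.2 _ hx).eq_of_tgt (M.map (back _)) 0, zero_comp]

theorem map_transferHom_restrictHom_of_ne {M : Lindner O ⥤ ModuleCat.{v} k}
    (hM : IsAboveMackey.{u, v} O H k M) (hH : O.rel H ⊤) {R : Set (Subgroup G)}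
    (hR : IsConjTransversal L (maximalSet O H L) R) (hJ : J ∈ R) (hJ' : J' ∈ R) (hne : J ≠ J') :
    M.map (transferHom O (rel_of_mem_maximalSet hH (hR.mem hJ)) ≫
      restrictHom O (le_of_mem_maximalSet (hR.mem hJ'))) = 0 := by
  have := hM.1
  let P := mackeySpan (rel_of_mem_maximalSet hH (hR.mem hJ)) (le_of_mem_maximalSet (hR.mem hJ'))
  have := Fintype.ofFinite (Quotient (orbitRel G P.apex))
  rw [transferHom_restrictHom, map_toHom_eq_sum_orbits]
  refine Finset.sum_eq_zero fun ω _ => map_orbitSpan_eq_zero hM _ _ fun h => hne ?_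
  obtain ⟨a, b, hl, e, -⟩ := conj_eq_of_isAbove_mackeySpan hH (hR.mem hJ) (hR.mem hJ') _ h
  exact hR.eq_of_conj_eq hJ hJ' hl e

/-- The point `(nJ, J)` of `G/J ×_{G/L} G/J`, for `n` in `N_L(J)`. -/
def mackeyPoint (h : O.rel J L) (n : normalizerIn L J) :
    (mackeySpan h (O.le_of_rel h)).apex :=
  ⟨(rightMul n (QuotientGroup.mk 1 : G ⧸ J), (QuotientGroup.mk 1 : G ⧸ J)),
    orbitMap_rightMul _ n _⟩

/-- The orbit of `(nJ, J)` is the graph of the automorphism `gJ ↦ gnJ` of `G/J`; it is identified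
with `G/J` by the second projection. -/
theorem map_orbitSpan_mackeyPoint {C : Type*} [Category* C] (M : Lindner O ⥤ C) (h : O.rel J L)
    (n : normalizerIn L J) :
    M.map (((mackeySpan h (O.le_of_rel h)).orbitSpan (mackeyPoint h n)).toHom
      (S := orbitObj O J) (T := orbitObj O J)) =
      M.map (back (rightMul n) : orbitObj O J ⟶ orbitObj O J) := by
  refine congrArg M.map (Span.toHom_eq ?_)
  let Q := (mackeySpan h (O.le_of_rel h)).orbitSpan (mackeyPoint h n)
  have hQ : ∀ y, rightMul n (Q.right y) = Q.left y := by
    intro y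
    obtain ⟨g, rfl⟩ := QuotientGroup.mk_surjective y
    exact map_smul (rightMul n) g (QuotientGroup.mk 1 : G ⧸ J)
  refine ⟨Q.right, ⟨fun y z e => orbitIncl_injective _ (Subtype.ext (Prod.ext ?_ e)), fun x => ?_⟩,
    hQ, fun _ => rfl⟩
  · exact (hQ y).symm.trans ((congrArg (rightMul n) e).trans (hQ z))
  · obtain ⟨g, rfl⟩ := QuotientGroup.mk_surjective x
    exact ⟨QuotientGroup.mk g, congrArg (fun y : G => (y : G ⧸ J)) (mul_one g)⟩

/-- A transfer from `G/J` to `G/L` followed by the restriction to `G/J` is the sum of the Weyl group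
action: the other orbits of `G/J ×_{G/L} G/J` have stabilizers that are not above `[H]^O`. -/
theorem map_transferHom_restrictHom_self {M : Lindner O ⥤ ModuleCat.{v} k}
    (hM : IsAboveMackey.{u, v} O H k M) (hH : O.rel H ⊤) (hJ : J ∈ maximalSet O H L)
    [Fintype (WeylGroup L J)] (m : M.obj (orbitObj O J)) :
    (M.map (transferHom O (rel_of_mem_maximalSet hH hJ) ≫
      restrictHom O (le_of_mem_maximalSet hJ))).hom m = ∑ w, weylRep M L J w m := by
  have := hM.1
  have hr := rel_of_mem_maximalSet hH hJ
  let P := mackeySpan hr (O.le_of_rel hr)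
  have := Fintype.ofFinite (Quotient (orbitRel G P.apex))
  have key : M.map (transferHom O (rel_of_mem_maximalSet hH hJ) ≫
      restrictHom O (le_of_mem_maximalSet hJ)) =
      ∑ w : WeylGroup L J, M.map (back (rightMul w.out) : orbitObj O J ⟶ orbitObj O J) := by
    rw [transferHom_restrictHom, map_toHom_eq_sum_orbits]
    refine (Fintype.sum_of_injective
      (fun w : WeylGroup L J => Quotient.mk (orbitRel G P.apex) (mackeyPoint hr w.out))
      ?_ _ _ ?_ ?_).symm
    -- Points `(nJ, J)` and `(n'J, J)` in one `G`-orbit are related by an element of `J`.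
    · intro w w' e
      obtain ⟨g, hg⟩ := Quotient.exact e
      have h1 : (QuotientGroup.mk (g * (1 * ((w'.out : normalizerIn L J) : G))) : G ⧸ J) =
          (QuotientGroup.mk (1 * ((w.out : normalizerIn L J) : G)) : G ⧸ J) :=
        congrArg (fun p => p.1.1) hg
      have h2 : (QuotientGroup.mk (g * 1) : G ⧸ J) = (QuotientGroup.mk 1 : G ⧸ J) :=
        congrArg (fun p => p.1.2) hg
      rw [QuotientGroup.eq] at h1 h2
      have h3 : g ∈ J := by simpa using h2
      have h4 := (Subgroup.mem_normalizer_iff''.1 w'.out.2.2 g).1 h3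
      have h5 := J.mul_mem h4 h1
      rw [← QuotientGroup.out_eq' w, ← QuotientGroup.out_eq' w']
      refine (QuotientGroup.eq.2 ?_).symm
      rw [Subgroup.mem_subgroupOf]
      have h6 : ((w'.out : normalizerIn L J) : G)⁻¹ * g * w'.out *
          ((g * (1 * w'.out))⁻¹ * (1 * w.out)) =
          ((w'.out : normalizerIn L J) : G)⁻¹ * w.out := by group
      rw [h6] at h5
      exact h5
    -- A point `(aJ, bJ)` with stabilizer above `[H]^O` is the translate by `b` of `(nJ, J)` with
    -- `n = b⁻¹a` in `N_L(J)`.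
    · intro ω hω
      refine map_orbitSpan_eq_zero hM _ _ fun h => hω ?_
      obtain ⟨a, b, hl, e, hp⟩ := conj_eq_of_isAbove_mackeySpan hH hJ hJ _ h
      let n : normalizerIn L J := ⟨b⁻¹ * a, hl, mem_normalizer_of_conj_eq e⟩
      refine ⟨(n : WeylGroup L J), ?_⟩
      rw [← ω.out_eq]
      refine Quotient.sound ⟨b⁻¹, Subtype.ext ?_⟩
      change b⁻¹ • (ω.out).1 = _
      rw [hp]
      have h7 : (n : WeylGroup L J) = ((n : WeylGroup L J).out : WeylGroup L J) :=
        (QuotientGroup.out_eq' _).symm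
      have h8 := QuotientGroup.eq.1 h7
      rw [Subgroup.mem_subgroupOf] at h8
      refine Prod.ext (QuotientGroup.eq.2 ?_) (QuotientGroup.eq.2 ?_)
      · change (b⁻¹ * a)⁻¹ * (1 * ((n : WeylGroup L J).out : normalizerIn L J)) ∈ J
        rw [one_mul]
        exact h8
      · change (b⁻¹ * b)⁻¹ * 1 ∈ J
        simp [J.one_mem]
    · intro w
      rw [← map_orbitSpan_mackeyPoint M hr]
      exact map_orbitSpan_congr M P ((orbitRel G P.apex).symm (Quotient.mk_out _))
  rw [key, ModuleCat.hom_sum, LinearMap.sum_apply]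
  refine Finset.sum_congr rfl fun w _ => ?_
  conv_rhs => rw [← QuotientGroup.out_eq' w]
  rfl

end DoubleCoset

/-! ### Generation of the Kan extensions by transfers and restrictions -/

section Kan

variable {G : Type u} [Group G] [Finite G] {O : TransferSystem G} {H L J K : Subgroup G}
  {k : Type} [CommRing k]

theorem indAdj_unit_app_hom (hH : O.rel H ⊤) (N : ClassMackey.{u, v} O H k) :
    ((indAdj.{u, v} k hH).unit.app N).hom = (familyIncl O H).leftKanExtensionUnit N.obj := by
  have := ((familyIncl O H).lanAdjunction (ModuleCat.{v} k)).map_restrictFullyFaithful_unit_app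
    (IsClassMackey.{u, v} O H k).fullyFaithfulι (IsAboveMackey.{u, v} O H k).fullyFaithfulι
    (L := indFunctor.{u, v} O H k) (R := resFunctor.{u, v} k hH) (Iso.refl _) (Iso.refl _) N
  refine this.trans ?_
  rw [Functor.lanAdjunction_unit]
  ext S : 2
  change _ ≫ 𝟙 _ ≫ 𝟙 _ = _
  rw [Category.comp_id, Category.comp_id]
  rfl

theorem coindAdj_counit_app_hom (hH : O.rel H ⊤) (N : ClassMackey.{u, v} O H k) :
    ((coindAdj.{u, v} k hH).counit.app N).hom = (familyIncl O H).ranCounit.app N.obj := by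
  have := ((familyIncl O H).ranAdjunction (ModuleCat.{v} k)).map_restrictFullyFaithful_counit_app
    (IsAboveMackey.{u, v} O H k).fullyFaithfulι (IsClassMackey.{u, v} O H k).fullyFaithfulι
    (L := resFunctor.{u, v} k hH) (R := coindFunctor.{u, v} O H k) (Iso.refl _) (Iso.refl _) N
  refine this.trans ?_
  rw [Functor.ranAdjunction_counit]
  ext S : 2
  exact (Category.id_comp _).trans (Category.id_comp _)

/-- The component of the unit of the induction adjunction at an object of `A^O_(H)`. -/
noncomputable def indUnit (hH : O.rel H ⊤) (N : ClassMackey.{u, v} O H k) (S : FamilyLindner O H) :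
    N.obj.obj S ⟶ ((indFunctor.{u, v} O H k).obj N).obj.obj S.obj :=
  ((indAdj.{u, v} k hH).unit.app N).hom.app S

/-- The component of the counit of the coinduction adjunction at an object of `A^O_(H)`. -/
noncomputable def coindCounit (hH : O.rel H ⊤) (N : ClassMackey.{u, v} O H k)
    (S : FamilyLindner O H) :
    ((coindFunctor.{u, v} O H k).obj N).obj.obj S.obj ⟶ N.obj.obj S :=
  ((coindAdj.{u, v} k hH).counit.app N).hom.app S

/-- `indUnit` at `G/J`, with `(familyOrbit O H hJ).obj` written as `orbitObj O J` in the target; the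
two agree only after unfolding `familyOrbit`, which rewriting does not do. -/
noncomputable def indUnitOrbit (hH : O.rel H ⊤) (N : ClassMackey.{u, v} O H k)
    (hJ : IsSubconj J H) : N.obj.obj (familyOrbit O H hJ) ⟶
      ((indFunctor.{u, v} O H k).obj N).obj.obj (orbitObj O J) :=
  indUnit hH N (familyOrbit O H hJ)

/-- `coindCounit` at `G/J`, with the source written as for `indUnitOrbit`. -/
noncomputable def coindCounitOrbit (hH : O.rel H ⊤) (N : ClassMackey.{u, v} O H k)
    (hJ : IsSubconj J H) : ((coindFunctor.{u, v} O H k).obj N).obj.obj (orbitObj O J) ⟶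
      N.obj.obj (familyOrbit O H hJ) :=
  coindCounit hH N (familyOrbit O H hJ)

theorem indUnit_map (hH : O.rel H ⊤) (N : ClassMackey.{u, v} O H k) (S : FamilyLindner O H)
    (hJ : IsSubconj J H) (f : S.obj ⟶ orbitObj O J) :
    indUnit hH N S ≫ ((indFunctor.{u, v} O H k).obj N).obj.map f =
      N.obj.map (X := S) (Y := familyOrbit O H hJ) (ObjectProperty.homMk f) ≫
        indUnitOrbit hH N hJ :=
  (((indAdj.{u, v} k hH).unit.app N).hom.naturality (X := S) (Y := familyOrbit O H hJ)
    (ObjectProperty.homMk f)).symm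

theorem indUnitOrbit_map (hH : O.rel H ⊤) (N : ClassMackey.{u, v} O H k)
    (hK : IsSubconj K H) (hJ : IsSubconj J H) (f : orbitObj O K ⟶ orbitObj O J) :
    indUnitOrbit hH N hK ≫ ((indFunctor.{u, v} O H k).obj N).obj.map f =
      N.obj.map (X := familyOrbit O H hK) (Y := familyOrbit O H hJ) (ObjectProperty.homMk f) ≫
        indUnitOrbit hH N hJ :=
  indUnit_map hH N (familyOrbit O H hK) hJ f

theorem map_coindCounit (hH : O.rel H ⊤) (N : ClassMackey.{u, v} O H k) (S : FamilyLindner O H)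
    (hJ : IsSubconj J H) (f : orbitObj O J ⟶ S.obj) :
    ((coindFunctor.{u, v} O H k).obj N).obj.map f ≫ coindCounit hH N S =
      coindCounitOrbit hH N hJ ≫
        N.obj.map (X := familyOrbit O H hJ) (Y := S) (ObjectProperty.homMk f) :=
  ((coindAdj.{u, v} k hH).counit.app N).hom.naturality (X := familyOrbit O H hJ) (Y := S)
    (ObjectProperty.homMk f)

theorem map_coindCounitOrbit (hH : O.rel H ⊤) (N : ClassMackey.{u, v} O H k)
    (hK : IsSubconj K H) (hJ : IsSubconj J H) (f : orbitObj O J ⟶ orbitObj O K) :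
    ((coindFunctor.{u, v} O H k).obj N).obj.map f ≫ coindCounitOrbit hH N hK =
      coindCounitOrbit hH N hJ ≫
        N.obj.map (X := familyOrbit O H hJ) (Y := familyOrbit O H hK) (ObjectProperty.homMk f) :=
  map_coindCounit hH N (familyOrbit O H hK) hJ f

/-- Maps out of `(Ind N)(X)` are determined on the images of the values of `N`: this is the
pointwise formula for the left Kan extension. -/
theorem ind_hom_ext (hH : O.rel H ⊤) (N : ClassMackey.{u, v} O H k) {X : Lindner O}
    {A : ModuleCat.{v} k} {φ ψ : ((indFunctor.{u, v} O H k).obj N).obj.obj X ⟶ A}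
    (h : ∀ (S : FamilyLindner O H) (f : S.obj ⟶ X),
      indUnit hH N S ≫ ((indFunctor.{u, v} O H k).obj N).obj.map f ≫ φ =
      indUnit hH N S ≫ ((indFunctor.{u, v} O H k).obj N).obj.map f ≫ ψ) : φ = ψ := by
  refine (((familyIncl O H).isPointwiseLeftKanExtensionLeftKanExtensionUnit N.obj) X).hom_ext'
    fun S f => ?_
  have := h S f
  rw [indUnit, indAdj_unit_app_hom] at this
  exact this

/-- Maps into `(CoInd N)(X)` are determined by their projections to the values of `N`: this is the
pointwise formula for the right Kan extension. -/
theorem coind_hom_ext (hH : O.rel H ⊤) (N : ClassMackey.{u, v} O H k) {X : Lindner O}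
    {A : ModuleCat.{v} k} {φ ψ : A ⟶ ((coindFunctor.{u, v} O H k).obj N).obj.obj X}
    (h : ∀ (S : FamilyLindner O H) (f : X ⟶ S.obj),
      φ ≫ ((coindFunctor.{u, v} O H k).obj N).obj.map f ≫ coindCounit hH N S =
      ψ ≫ ((coindFunctor.{u, v} O H k).obj N).obj.map f ≫ coindCounit hH N S) : φ = ψ := by
  refine (((familyIncl O H).isPointwiseRightKanExtensionRanCounit N.obj) X).hom_ext'
    fun S f => ?_
  have := h S f
  rw [coindCounit, coindAdj_counit_app_hom] at this
  exact this

variable {R : Set (Subgroup G)}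

/-- A map out of `(Ind N)(G/L)` that vanishes on the formal transfers is zero.  By the pointwise
formula and the decomposition along orbits, `(Ind N)(G/L)` is generated by transfers along maps
`G/K → G/L` with `K ∈ [H]^O`, and each of these factors through a maximal one. -/
theorem ind_hom_eq_zero (hH : O.rel H ⊤) (hR : IsConjTransversal L (maximalSet O H L) R)
    (N : ClassMackey.{u, v} O H k) {A : ModuleCat.{v} k}
    (φ : ((indFunctor.{u, v} O H k).obj N).obj.obj (orbitObj O L) ⟶ A)
    (hφ : ∀ (J : Subgroup G) (hJ : J ∈ R),
      indUnitOrbit hH N (isSubconj_of_mem_maximalSet (hR.mem hJ)) ≫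
        ((indFunctor.{u, v} O H k).obj N).obj.map
          (transferHom O (rel_of_mem_maximalSet hH (hR.mem hJ))) ≫ φ = 0) : φ = 0 := by
  have := ((indFunctor.{u, v} O H k).obj N).property.1
  refine ind_hom_ext hH N fun S f => ?_
  obtain ⟨P, rfl⟩ := Span.toHom_surjective f
  have := Fintype.ofFinite (Quotient (orbitRel G P.apex))
  rw [comp_zero, comp_zero, map_toHom_eq_sum_orbits, Preadditive.sum_comp, Preadditive.comp_sum]
  refine Finset.sum_eq_zero fun ω _ => ?_
  generalize ω.out = x
  have hx : IsSubconj (stabilizer G x) H := familyProp_of_map (S := S) (U := ⟨P.apex⟩) P.left x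
  have hadm : IsAdmissible O (P.right.comp (orbitIncl x)) := (P.orbitSpan x).admissible
  have hn := indUnit_map hH N S hx (back (P.left.comp (orbitIncl x)))
  suffices h0 : N.obj.map (X := S) (Y := familyOrbit O H hx)
      (ObjectProperty.homMk (back (P.left.comp (orbitIncl x)))) ≫ indUnitOrbit hH N hx ≫
      ((indFunctor.{u, v} O H k).obj N).obj.map (fwd (S := orbitObj O (stabilizer G x))
        (P.right.comp (orbitIncl x)) hadm) ≫ φ = 0 by
    rw [map_orbitSpan, Category.assoc, ← Category.assoc, hn, Category.assoc]
    exact h0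
  by_cases hi : Inseparable O H (stabilizer G x)
  · obtain ⟨J, hJ, h₁, e⟩ := exists_factor_orbitMap hH hR P.right x hi
    have hadm₁ : IsAdmissible O h₁ := hadm.of_comp h₁ _ e
    have hf : fwd (S := orbitObj O (stabilizer G x)) (T := orbitObj O L)
        (P.right.comp (orbitIncl x)) hadm =
        fwd (S := orbitObj O (stabilizer G x)) (T := orbitObj O J) h₁ hadm₁ ≫
          transferHom O (rel_of_mem_maximalSet hH (hR.mem hJ)) := by
      have hc : (orbitMap (le_of_mem_maximalSet (hR.mem hJ))).comp h₁ =
        P.right.comp (orbitIncl x) := MulActionHom.ext e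
      refine ((fwd_comp_fwd _ _ _ _ (by rw [hc]; exact hadm)).trans ?_).symm
      congr 1
    rw [hf, Functor.map_comp, Category.assoc, ← Category.assoc (indUnitOrbit hH N hx),
      indUnitOrbit_map hH N hx (isSubconj_of_mem_maximalSet (hR.mem hJ)), Category.assoc, hφ J hJ,
      comp_zero, comp_zero]
  · rw [(N.property.2 _ hx hi).eq_of_tgt (N.obj.map _) 0, zero_comp]

/-- A map into `(CoInd N)(G/L)` that vanishes under the formal restrictions is zero, since
restrictions along maps `G/K → G/L` with `K ∈ [H]^O` factor through the formal ones and detect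
elements of `(CoInd N)(G/L)`. -/
theorem coind_hom_eq_zero (hH : O.rel H ⊤) (hR : IsConjTransversal L (maximalSet O H L) R)
    (N : ClassMackey.{u, v} O H k) {A : ModuleCat.{v} k}
    (φ : A ⟶ ((coindFunctor.{u, v} O H k).obj N).obj.obj (orbitObj O L))
    (hφ : ∀ (J : Subgroup G) (hJ : J ∈ R),
      φ ≫ ((coindFunctor.{u, v} O H k).obj N).obj.map
          (restrictHom O (le_of_mem_maximalSet (hR.mem hJ))) ≫
        coindCounitOrbit hH N (isSubconj_of_mem_maximalSet (hR.mem hJ)) = 0) :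
    φ = 0 := by
  have := ((coindFunctor.{u, v} O H k).obj N).property.1
  refine coind_hom_ext hH N fun S f => ?_
  obtain ⟨P, rfl⟩ := Span.toHom_surjective f
  have := Fintype.ofFinite (Quotient (orbitRel G P.apex))
  rw [zero_comp, map_toHom_eq_sum_orbits, Preadditive.sum_comp, Preadditive.comp_sum]
  refine Finset.sum_eq_zero fun ω _ => ?_
  generalize ω.out = x
  have hx : IsSubconj (stabilizer G x) H := familyProp_of_map (S := S) (U := ⟨P.apex⟩) P.right x
  have hadm : IsAdmissible O (P.right.comp (orbitIncl x)) := (P.orbitSpan x).admissible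
  have hn := map_coindCounit hH N S hx (fwd (P.right.comp (orbitIncl x)) hadm)
  suffices h0 : φ ≫ ((coindFunctor.{u, v} O H k).obj N).obj.map
      (back (S := orbitObj O L) (T := orbitObj O (stabilizer G x))
        (P.left.comp (orbitIncl x))) ≫ coindCounitOrbit hH N hx = 0 by
    rw [map_orbitSpan, Category.assoc, hn]
    have h1 := congrArg (· ≫ N.obj.map (X := familyOrbit O H hx) (Y := S)
      (ObjectProperty.homMk (fwd (P.right.comp (orbitIncl x)) hadm))) h0
    simp only [Category.assoc, zero_comp] at h1
    exact h1
  by_cases hi : Inseparable O H (stabilizer G x)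
  · obtain ⟨J, hJ, h₁, e⟩ := exists_factor_orbitMap hH hR P.left x hi
    have hb : back (S := orbitObj O L) (T := orbitObj O (stabilizer G x))
        (P.left.comp (orbitIncl x)) = restrictHom O (le_of_mem_maximalSet (hR.mem hJ)) ≫
        back (S := orbitObj O J) (T := orbitObj O (stabilizer G x)) h₁ := by
      have hc : (orbitMap (le_of_mem_maximalSet (hR.mem hJ))).comp h₁ =
        P.left.comp (orbitIncl x) := MulActionHom.ext e
      exact ((back_comp_back _ _).trans (congrArg back hc)).symm
    have h1 := congrArg (· ≫ N.obj.map (ObjectProperty.homMk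
      (back (S := orbitObj O J) (T := orbitObj O (stabilizer G x)) h₁) :
        familyOrbit O H (isSubconj_of_mem_maximalSet (hR.mem hJ)) ⟶ familyOrbit O H hx)) (hφ J hJ)
    rw [hb, Functor.map_comp, Category.assoc,
      map_coindCounitOrbit hH N hx (isSubconj_of_mem_maximalSet (hR.mem hJ))]
    simpa only [Category.assoc, zero_comp] using h1
  · rw [(N.property.2 _ hx hi).eq_of_tgt (coindCounitOrbit hH N hx) 0, comp_zero, comp_zero]

theorem iSup_range_formalTransfer (hH : O.rel H ⊤)
    (hR : IsConjTransversal L (maximalSet O H L) R) (N : ClassMackey.{u, v} O H k) :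
    ⨆ J : R, LinearMap.range (formalTransfer hH N (hR.mem J.2)) = ⊤ := by
  set W := ⨆ J : R, LinearMap.range (formalTransfer hH N (hR.mem J.2)) with hW
  have h0 : ModuleCat.ofHom W.mkQ = 0 := by
    refine ind_hom_eq_zero hH hR N _ fun J hJ => ModuleCat.hom_ext (LinearMap.ext fun m => ?_)
    refine (Submodule.Quotient.mk_eq_zero W).2 ?_
    exact le_iSup (fun J : R => LinearMap.range (formalTransfer hH N (hR.mem J.2))) ⟨J, hJ⟩ ⟨m, rfl⟩
  have h1 : W.mkQ = 0 := congrArg ModuleCat.Hom.hom h0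
  rw [← W.ker_mkQ, h1, LinearMap.ker_zero]

theorem eq_zero_of_formalRestriction (hH : O.rel H ⊤)
    (hR : IsConjTransversal L (maximalSet O H L) R) (N : ClassMackey.{u, v} O H k)
    (y : ((coindFunctor.{u, v} O H k).obj N).obj.obj (orbitObj O L))
    (hy : ∀ J : R, formalRestriction hH N (hR.mem J.2) y = 0) : y = 0 := by
  let W := LinearMap.ker (LinearMap.pi fun J : R => formalRestriction hH N (hR.mem J.2))
  have h0 : ModuleCat.ofHom W.subtype = 0 := by
    refine coind_hom_eq_zero hH hR N _ fun J hJ => ModuleCat.hom_ext (LinearMap.ext fun m => ?_)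
    exact congrFun (LinearMap.mem_ker.1 m.2) ⟨J, hJ⟩
  have h1 : W.subtype = 0 := congrArg ModuleCat.Hom.hom h0
  exact LinearMap.congr_fun h1 ⟨y, LinearMap.mem_ker.2 (funext hy)⟩

/-! ### The comparison map on formal transfers and restrictions -/

theorem formalTransfer_weylRep (hH : O.rel H ⊤) (M : AboveMackey.{u, v} O H k)
    (hJ : J ∈ maximalSet O H L) (w : WeylGroup L J) :
    formalTransfer hH ((resFunctor.{u, v} k hH).obj M) hJ ∘ₗ weylRep M.obj L J w =
      formalTransfer hH ((resFunctor.{u, v} k hH).obj M) hJ := by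
  obtain ⟨n, rfl⟩ := QuotientGroup.mk_surjective w
  let N := (resFunctor.{u, v} k hH).obj M
  let b : orbitObj O J ⟶ orbitObj O J := back (rightMul n)
  have hr := rel_of_mem_maximalSet hH hJ
  have hs := isSubconj_of_mem_maximalSet hJ
  have h : (N.obj.map (ObjectProperty.homMk b : familyOrbit O H hs ⟶ familyOrbit O H hs) ≫
      indUnitOrbit hH N hs) ≫ ((indFunctor.{u, v} O H k).obj N).obj.map (transferHom O hr) =
      indUnitOrbit hH N hs ≫ ((indFunctor.{u, v} O H k).obj N).obj.map (transferHom O hr) := by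
    rw [← indUnitOrbit_map, Category.assoc, ← Functor.map_comp, back_rightMul_transferHom]
  exact congrArg ModuleCat.Hom.hom h

theorem weylRep_formalRestriction (hH : O.rel H ⊤) (M : AboveMackey.{u, v} O H k)
    (hJ : J ∈ maximalSet O H L) (w : WeylGroup L J)
    (y : (coindRes.{u, v} hH M).obj.obj (orbitObj O L)) :
    weylRep M.obj L J w (formalRestriction hH ((resFunctor.{u, v} k hH).obj M) hJ y) =
      formalRestriction hH ((resFunctor.{u, v} k hH).obj M) hJ y := by
  obtain ⟨n, rfl⟩ := QuotientGroup.mk_surjective w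
  let N := (resFunctor.{u, v} k hH).obj M
  let b : orbitObj O J ⟶ orbitObj O J := back (rightMul n)
  have hr := le_of_mem_maximalSet hJ
  have hs := isSubconj_of_mem_maximalSet hJ
  have h : ((coindFunctor.{u, v} O H k).obj N).obj.map (restrictHom O hr) ≫
      coindCounitOrbit hH N hs ≫
      N.obj.map (ObjectProperty.homMk b : familyOrbit O H hs ⟶ familyOrbit O H hs) =
      ((coindFunctor.{u, v} O H k).obj N).obj.map (restrictHom O hr) ≫
      coindCounitOrbit hH N hs := by
    rw [← map_coindCounitOrbit, ← Category.assoc, ← Functor.map_comp, restrictHom_back_rightMul]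
  exact LinearMap.congr_fun (congrArg ModuleCat.Hom.hom h) y

/-- The comparison map, between a formal transfer and a formal restriction, is a transfer followed
by a restriction in `M`: this is the content of the triangle identities. -/
theorem formalRestriction_comparison_formalTransfer {J' : Subgroup G} (hH : O.rel H ⊤)
    (M : AboveMackey.{u, v} O H k) (hJ : J ∈ maximalSet O H L) (hJ' : J' ∈ maximalSet O H L)
    (m : M.obj.obj (orbitObj O J)) :
    formalRestriction hH ((resFunctor.{u, v} k hH).obj M) hJ'
      (((comparison hH M).hom.app (orbitObj O L)).hom
        (formalTransfer hH ((resFunctor.{u, v} k hH).obj M) hJ m)) =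
      (M.obj.map (transferHom O (rel_of_mem_maximalSet hH hJ) ≫
        restrictHom O (le_of_mem_maximalSet hJ'))).hom m := by
  let N := (resFunctor.{u, v} k hH).obj M
  let K : FamilyLindner O H := familyOrbit O H (isSubconj_of_mem_maximalSet hJ)
  let K' : FamilyLindner O H := familyOrbit O H (isSubconj_of_mem_maximalSet hJ')
  let ε := ((indAdj.{u, v} k hH).counit.app M).hom
  let η := ((coindAdj.{u, v} k hH).unit.app M).hom
  have t1 : indUnit hH N K ≫ ε.app K.obj = 𝟙 _ :=
    congrArg (fun f => f.hom.app K) ((indAdj.{u, v} k hH).right_triangle_components M)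
  have t2 : η.app K'.obj ≫ coindCounit hH N K' = 𝟙 _ :=
    congrArg (fun f => f.hom.app K') ((coindAdj.{u, v} k hH).left_triangle_components M)
  have n1 := ε.naturality (X := K.obj) (transferHom O (rel_of_mem_maximalSet hH hJ))
  have n2 := η.naturality (Y := K'.obj) (restrictHom O (le_of_mem_maximalSet hJ'))
  have h : ∀ m, (ε.app (orbitObj O L)).hom (formalTransfer hH N hJ m) =
      (M.obj.map (transferHom O (rel_of_mem_maximalSet hH hJ))).hom m := fun m => by
    have e1 := LinearMap.congr_fun (congrArg ModuleCat.Hom.hom n1) ((indUnit hH N K).hom m)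
    have e2 := LinearMap.congr_fun (congrArg ModuleCat.Hom.hom t1) m
    exact e1.trans (congrArg (M.obj.map (transferHom O (rel_of_mem_maximalSet hH hJ))).hom e2)
  have h' : ∀ y, formalRestriction hH N hJ' ((η.app (orbitObj O L)).hom y) =
      (M.obj.map (restrictHom O (le_of_mem_maximalSet hJ'))).hom y := fun y => by
    have e1 := LinearMap.congr_fun (congrArg ModuleCat.Hom.hom n2) y
    have e2 := LinearMap.congr_fun (congrArg ModuleCat.Hom.hom t2)
      ((M.obj.map (restrictHom O (le_of_mem_maximalSet hJ'))).hom y)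
    exact (congrArg (coindCounit hH N K').hom e1.symm).trans e2
  rw [M.obj.map_comp]
  exact (congrArg (fun y => formalRestriction hH N hJ' ((η.app (orbitObj O L)).hom y)) (h m)).trans
    (h' _)

end Kan

/-- The value of the comparison map at `G/L`, for a fixed choice of representatives. -/
theorem comparison_app_presentation {G : Type u} [Group G] [Finite G] [DecidableEq (Subgroup G)]
    {O : TransferSystem G} {H : Subgroup G} (hH : O.rel H ⊤) (M : AboveMackey.{u, v} O H ℚ)
    {L : Subgroup G} {R : Set (Subgroup G)} (hR : IsConjTransversal L (maximalSet O H L) R) :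
    Function.Bijective ((comparison hH M).hom.app (orbitObj O L)).hom ∧
      ∃ (eInd : (⨁ J : R, (weylRep M.obj L J.1).Coinvariants) ≃ₗ[ℚ]
          (indRes hH M).obj.obj (orbitObj O L))
        (eCoind : (coindRes hH M).obj.obj (orbitObj O L) ≃ₗ[ℚ]
          (∀ J : R, (weylRep M.obj L J.1).invariants)),
        (∀ (J : R) (m : M.obj.obj (orbitObj O J.1)),
          eInd (DirectSum.lof ℚ R (fun J => (weylRep M.obj L J.1).Coinvariants) J
            (Representation.Coinvariants.mk (weylRep M.obj L J.1) m)) =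
          formalTransfer hH ((resFunctor ℚ hH).obj M) (hR.1 J.2) m) ∧
        (∀ (y : (coindRes hH M).obj.obj (orbitObj O L)) (J : R),
          (eCoind y J : M.obj.obj (orbitObj O J.1)) =
          formalRestriction hH ((resFunctor ℚ hH).obj M) (hR.1 J.2) y) ∧
        ∀ (x : ⨁ J : R, (weylRep M.obj L J.1).Coinvariants) (J : R),
          eCoind (((comparison hH M).hom.app (orbitObj O L)).hom (eInd x)) J =
          traceMap (weylRep M.obj L J.1) (x J) := by
  refine exists_linearEquiv_of_trace (fun J : R => weylRep M.obj L J.1)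
    ((comparison hH M).hom.app (orbitObj O L)).hom
    (fun J => formalTransfer hH ((resFunctor ℚ hH).obj M) (hR.1 J.2))
    (fun J => formalRestriction hH ((resFunctor ℚ hH).obj M) (hR.1 J.2))
    (fun J w => formalTransfer_weylRep hH M (hR.1 J.2) w)
    (fun J w y => weylRep_formalRestriction hH M (hR.1 J.2) w y)
    (iSup_range_formalTransfer hH hR _) (eq_zero_of_formalRestriction hH hR _)
    (fun J m => ?_) (fun J J' hne m => ?_)
  · have := Fintype.ofFinite (WeylGroup L J.1)
    refine (formalRestriction_comparison_formalTransfer hH M (hR.1 J.2) (hR.1 J.2) m).trans ?_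
    rw [map_transferHom_restrictHom_self M.property hH (hR.1 J.2), traceMap_mk]
  · refine (formalRestriction_comparison_formalTransfer hH M (hR.1 J.2) (hR.1 J'.2) m).trans ?_
    rw [map_transferHom_restrictHom_of_ne M.property hH hR J.2 J'.2 fun h => hne (Subtype.ext h)]
    rfl

end IncompleteMackey

theorem mainTheorem6 {G : Type u} [Group G] [Finite G] [DecidableEq (Subgroup G)]
    (O : TransferSystem G) (H : Subgroup G) (hH : O.rel H ⊤) (M : AboveMackey.{u, v} O H ℚ) :
    IsIso (comparison hH M) ∧
    ∀ (L : Subgroup G) (R : Set (Subgroup G))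
      (hR : IsConjTransversal L (maximalSet O H L) R),
      ∃ (eInd : (⨁ J : R, (weylRep M.obj L J.1).Coinvariants) ≃ₗ[ℚ]
          (indRes hH M).obj.obj (orbitObj O L))
        (eCoind : (coindRes hH M).obj.obj (orbitObj O L) ≃ₗ[ℚ]
          (∀ J : R, (weylRep M.obj L J.1).invariants)),
        (∀ (J : R) (m : M.obj.obj (orbitObj O J.1)),
          eInd (DirectSum.lof ℚ R (fun J => (weylRep M.obj L J.1).Coinvariants) J
            (Representation.Coinvariants.mk (weylRep M.obj L J.1) m)) =
          formalTransfer hH ((resFunctor ℚ hH).obj M) (hR.1 J.2) m) ∧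
        (∀ (y : (coindRes hH M).obj.obj (orbitObj O L)) (J : R),
          (eCoind y J : M.obj.obj (orbitObj O J.1)) =
          formalRestriction hH ((resFunctor ℚ hH).obj M) (hR.1 J.2) y) ∧
        (∀ (x : ⨁ J : R, (weylRep M.obj L J.1).Coinvariants) (J : R),
          eCoind (((comparison hH M).hom.app (orbitObj O L)).hom (eInd x)) J =
          traceMap (weylRep M.obj L J.1) (x J)) ∧
        ∀ J : R, Function.Bijective (traceMap (weylRep M.obj L J.1)) := by
  refine ⟨?_, fun L R hR => ?_⟩
  · have := (indRes hH M).property.1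
    have := (coindRes hH M).property.1
    have h : IsIso (comparison hH M).hom := isIso_of_orbits _ fun L => by
      obtain ⟨R, hR⟩ := exists_isConjTransversal L (maximalSet O H L)
      exact (ConcreteCategory.isIso_iff_bijective _).2 (comparison_app_presentation hH M hR).1
    exact (isIso_iff_of_reflects_iso (comparison hH M) (IsAboveMackey.{u, v} O H ℚ).ι).1 h
  · obtain ⟨-, e, f, h1, h2, h3⟩ := comparison_app_presentation hH M hR
    exact ⟨e, f, h1, h2, h3, fun J => traceMap_bijective _⟩
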